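/- Let $k$ be an algebraically closed field of characteristic zero and let $X\subseteq\mathbb P^r$ be a smooth nondegenerate projective variety over $k$ (irreducible, reduced, contained in no hyperplane), with homogeneous ideal $I_X\subseteq S=k[x_0,\dots,x_r]$ and $L=\mathcal O_X(1)$. Let $a,b\ge 1$ and let $M$ be an $a\times b$ matrix of linear forms in $S$ which is $1$-generic, i.e. $AMB^{T}$ has no zero entry for any $(A,B)\in GL_a(k)\times GL_b(k)$. Suppose that the ideal $I_2(M)$ generated by the $2$-minors of $M$ satisfies $I_2(M)\subseteq I_X$. Then there exist line bundles $L_1,L_2$ on $X$, subspaces $V_i\subseteq H^0(X,L_i)$ (linear systems $|V_i|\subseteq|L_i|$), and an effective divisor $B\subset X$ with defining section $u\in H^0(X,\mathcal O_X(B))$, such that: 1. There are an isomorphism $L(-B)\cong L_1\otimes L_2$, a basis $s_0,\dots,s_{a-1}$ of $V_1$ and a basis $t_0,\dots,t_{b-1}$ of $V_2$ such that, under this isomorphism, $M_{i,j}|_X=s_it_ju$ in $H^0(X,L)$ for all $i,j$. 2. If $M$ is symmetric (so $a=b$), then there are an isomorphism $L_1\cong L_2$ and a scalar $\alpha\in k\setminus\{0\}$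 such that, under this isomorphism, $s_i=\alpha t_i$ for all $i$. 3. Neither $|V_1|$ nor $|V_2|$ has a fixed component, i.e. no prime divisor of $X$ is contained in the zero locus of every section in $V_1$, and likewise for $V_2$. -/

import Mathlib

open AlgebraicGeometry CategoryTheory TopologicalSpace

universe u

noncomputable section

namespace DetPres

/-! ### Restriction of functions -/

/-- Restriction of regular functions to a smaller open set. -/
def res {X : Scheme.{u}} {U V : X.Opens} (h : V ≤ U) : Γ(X, U) →+* Γ(X, V) :=
  (X.presheaf.map (homOfLE h).op).hom

theorem res_res {X : Scheme.{u}} {U V W : X.Opens} (h : V ≤ U) (h' : W ≤ V) (f : Γ(X, U)) :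
    res h' (res h f) = res (h'.trans h) f := by
  simp only [res]
  rw [← CommRingCat.comp_apply, ← X.presheaf.map_comp]
  rfl

theorem res_self {X : Scheme.{u}} {U : X.Opens} (h : U ≤ U) (f : Γ(X, U)) : res h f = f := by
  simp [res]

/-- Pullback of regular functions along a morphism. -/
def pull {X Y : Scheme.{u}} (p : X ⟶ Y) {U : Y.Opens} {V : X.Opens} (e : V ≤ p ⁻¹ᵁ U) :
    Γ(Y, U) →+* Γ(X, V) :=
  (p.appLE U V e).hom

theorem res_pull {X Y : Scheme.{u}} (p : X ⟶ Y) {U : Y.Opens} {V W : X.Opens}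
    (e : V ≤ p ⁻¹ᵁ U) (h : W ≤ V) (f : Γ(Y, U)) :
    res h (pull p e f) = pull p (h.trans e) f := by
  simp only [res, pull]
  rw [← CommRingCat.comp_apply, Scheme.Hom.appLE_map]

theorem pull_res {X Y : Scheme.{u}} (p : X ⟶ Y) {U U' : Y.Opens} {V : X.Opens}
    (h : U' ≤ U) (e : V ≤ p ⁻¹ᵁ U') (f : Γ(Y, U)) :
    pull p e (res h f) = pull p (e.trans (fun _ hx => h hx)) f := by
  simp only [res, pull]
  rw [← CommRingCat.comp_apply, Scheme.Hom.map_appLE]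

/-- The constant function on `U ⊆ X` with value `c`, for a scheme `X` over a field. -/
def scalar (k : Type u) [Field k] {X : Scheme.{u}} [X.Over (Spec (.of k))] (U : X.Opens) :
    k →+* Γ(X, U) :=
  (pull (X ↘ Spec (.of k)) (U := ⊤) (V := U) (fun _ _ => trivial)).comp
    (Scheme.ΓSpecIso (.of k)).inv.hom

theorem res_scalar (k : Type u) [Field k] {X : Scheme.{u}} [X.Over (Spec (.of k))]
    {U V : X.Opens} (h : V ≤ U) (c : k) : res h (scalar k U c) = scalar k V c := by
  simp only [scalar, RingHom.comp_apply]
  exact res_pull _ _ _ _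

/-! ### Line bundles given by transition functions -/

/-- A line bundle on a scheme: an open cover `U i` trivialising it, and transition functions
`g i j` on `U i ∩ U j` satisfying the cocycle condition (in particular `g i j * g j i = 1`). -/
structure LineBundle (X : Scheme.{u}) where
  I : Type u
  U : I → X.Opens
  cover : ⨆ i, U i = ⊤
  g : ∀ i j, Γ(X, U i ⊓ U j)
  g_self : ∀ i, g i i = 1
  g_mul : ∀ i j l (W : X.Opens) (hij : W ≤ U i ⊓ U j) (hjl : W ≤ U j ⊓ U l)
    (hil : W ≤ U i ⊓ U l), res hij (g i j) * res hjl (g j l) = res hil (g i l)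

namespace LineBundle

variable {X : Scheme.{u}}

/-- The global sections `H⁰(X, L)`: families of functions `s i` on `U i` with
`s i = g i j * s j` on `U i ∩ U j`. -/
def H0 (L : LineBundle X) : AddSubgroup (∀ i, Γ(X, L.U i)) where
  carrier := {s | ∀ i j, res inf_le_left (s i) = L.g i j * res inf_le_right (s j)}
  zero_mem' := by intro i j; simp
  add_mem' := by
    intro s t hs ht i j
    simp only [Pi.add_apply, map_add, hs i j, ht i j, mul_add]
  neg_mem' := by
    intro s hs i j
    simp only [Pi.neg_apply, map_neg, hs i j, mul_neg]

theorem H0.compat {L : LineBundle X} (s : L.H0) (i j : L.I) (W : X.Opens) (hi : W ≤ L.U i)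
    (hj : W ≤ L.U j) :
    res hi (s.1 i) = res (le_inf hi hj) (L.g i j) * res hj (s.1 j) := by
  have := congrArg (res (le_inf hi hj)) (s.2 i j)
  simpa only [map_mul, res_res] using this

section Scalars

variable (k : Type u) [Field k] [X.Over (Spec (.of k))]

instance (L : LineBundle X) : SMul k L.H0 where
  smul c s := ⟨fun i => scalar k (L.U i) c * s.1 i, by
    intro i j
    simp only [map_mul, res_scalar, s.2 i j]
    ring⟩

variable {k} in
theorem H0.smul_val (L : LineBundle X) (c : k) (s : L.H0) (i : L.I) :
    (c • s).1 i = scalar k (L.U i) c * s.1 i := rfl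

/-- For `X` over `k`, the space of global sections is a `k`-vector space. -/
instance (L : LineBundle X) : Module k L.H0 where
  one_smul s := by
    refine Subtype.ext (funext fun i => ?_)
    simp [H0.smul_val]
  mul_smul c d s := by
    refine Subtype.ext (funext fun i => ?_)
    simp [H0.smul_val, mul_assoc]
  smul_zero c := by
    refine Subtype.ext (funext fun i => ?_)
    simp [H0.smul_val]
  smul_add c s t := by
    refine Subtype.ext (funext fun i => ?_)
    simp [H0.smul_val, mul_add]
  add_smul c d s := by
    refine Subtype.ext (funext fun i => ?_)
    simp [H0.smul_val, add_mul]
  zero_smul s := by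
    refine Subtype.ext (funext fun i => ?_)
    simp [H0.smul_val]

end Scalars

/-- The section `s` of `L` vanishes at the point `x`. -/
def H0.VanishesAt {L : LineBundle X} (s : L.H0) (x : X) : Prop :=
  ∀ i, x ∈ L.U i → x ∉ X.basicOpen (s.1 i)

/-- A linear system `|V| ⊆ |L|` has no fixed component: no prime divisor, i.e. no irreducible
closed subset with generic point `x` of codimension one, lies in the zero locus of every member
of `V`. -/
def NoFixedComponent {k : Type u} [Field k] [X.Over (Spec (.of k))] {L : LineBundle X}
    (V : Submodule k L.H0) : Prop :=
  ∀ x : X, Order.coheight x = 1 → ∃ s ∈ V, ¬ H0.VanishesAt s x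

/-- The tensor product of two line bundles. -/
def tensor (L L' : LineBundle X) : LineBundle X where
  I := L.I × L'.I
  U p := L.U p.1 ⊓ L'.U p.2
  cover := by
    rw [iSup_prod, ← top_inf_eq (⊤ : X.Opens)]
    nth_rw 1 [← L.cover]
    rw [← L'.cover, iSup_inf_iSup, iSup_prod]
  g p q := res (inf_le_inf inf_le_left inf_le_left) (L.g p.1 q.1) *
    res (inf_le_inf inf_le_right inf_le_right) (L'.g p.2 q.2)
  g_self p := by simp [L.g_self, L'.g_self]
  g_mul p q o W h₁ h₂ h₃ := by
    simp only [map_mul, res_res]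
    rw [mul_mul_mul_comm, L.g_mul, L'.g_mul]

theorem mulSection_aux {L L' : LineBundle X} (s : L.H0) (t : L'.H0) (i i' : L.I) (j j' : L'.I)
    (W : X.Opens) (h : W ≤ L.U i ⊓ L'.U j) (h' : W ≤ L.U i' ⊓ L'.U j') :
    res h (res inf_le_left (s.1 i) * res inf_le_right (t.1 j)) =
      res (le_inf (h.trans inf_le_left) (h'.trans inf_le_left)) (L.g i i') *
        res (le_inf (h.trans inf_le_right) (h'.trans inf_le_right)) (L'.g j j') *
        res h' (res inf_le_left (s.1 i') * res inf_le_right (t.1 j')) := by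
  simp only [map_mul, res_res]
  rw [H0.compat s i i' W (h.trans inf_le_left) (h'.trans inf_le_left),
    H0.compat t j j' W (h.trans inf_le_right) (h'.trans inf_le_right)]
  ring

/-- The product `s ⊗ t ∈ H⁰(L ⊗ L')` of sections `s` of `L` and `t` of `L'`. -/
def mulSection {L L' : LineBundle X} (s : L.H0) (t : L'.H0) : (L.tensor L').H0 :=
  ⟨fun p => res inf_le_left (s.1 p.1) * res inf_le_right (t.1 p.2),
    fun p q => mulSection_aux s t p.1 q.1 p.2 q.2 _ inf_le_left inf_le_right⟩

/-- The dual (inverse) line bundle, whose transition functions are the inverses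
`g j i = (g i j)⁻¹`. -/
def dual (L : LineBundle X) : LineBundle X where
  I := L.I
  U := L.U
  cover := L.cover
  g i j := res (le_inf inf_le_right inf_le_left) (L.g j i)
  g_self i := by simp [L.g_self]
  g_mul i j l W h₁ h₂ h₃ := by
    simp only [res_res]
    rw [mul_comm, L.g_mul]

/-- A morphism `L ⟶ L'` of line bundles: in the trivialisations over `U i` and `U' j` it is
multiplication by a function `c j i` on `U' j ∩ U i`. -/
structure Hom (L L' : LineBundle X) where
  c : ∀ j i, Γ(X, L'.U j ⊓ L.U i)
  compat : ∀ j j' i i' (W : X.Opens) (h : W ≤ L'.U j ⊓ L.U i) (h' : W ≤ L'.U j' ⊓ L.U i')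
    (hi : W ≤ L.U i ⊓ L.U i') (hj : W ≤ L'.U j ⊓ L'.U j'),
    res h (c j i) * res hi (L.g i i') = res hj (L'.g j j') * res h' (c j' i')

namespace Hom

variable {L L' : LineBundle X}

/-- A morphism of line bundles is an isomorphism if it is locally multiplication by a unit. -/
def IsIso (φ : Hom L L') : Prop := ∀ j i, IsUnit (φ.c j i)

theorem existsUnique_local (φ : Hom L L') (s : L.H0) (j : L'.I) :
    ∃! f : Γ(X, L'.U j), ∀ i, res inf_le_left f = φ.c j i * res inf_le_right (s.1 i) := by
  refine X.sheaf.existsUnique_gluing' (fun i => L'.U j ⊓ L.U i) (L'.U j)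
    (fun i => homOfLE inf_le_left) ?_ (fun i => φ.c j i * res inf_le_right (s.1 i)) ?_
  · rw [← inf_iSup_eq, L.cover, inf_top_eq]
  · intro i i'
    have hi : (L'.U j ⊓ L.U i) ⊓ (L'.U j ⊓ L.U i') ≤ L.U i := inf_le_left.trans inf_le_right
    have hi' : (L'.U j ⊓ L.U i) ⊓ (L'.U j ⊓ L.U i') ≤ L.U i' := inf_le_right.trans inf_le_right
    have hj : (L'.U j ⊓ L.U i) ⊓ (L'.U j ⊓ L.U i') ≤ L'.U j := inf_le_left.trans inf_le_left
    have := φ.compat j j i i' _ inf_le_left inf_le_right (le_inf hi hi') (le_inf hj hj)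
    rw [L'.g_self, map_one, one_mul] at this
    have key : res (inf_le_left : (L'.U j ⊓ L.U i) ⊓ (L'.U j ⊓ L.U i') ≤ _)
          (φ.c j i * res inf_le_right (s.1 i)) =
        res inf_le_right (φ.c j i' * res inf_le_right (s.1 i')) := by
      simp only [map_mul, res_res]
      rw [H0.compat s i i' _ hi hi', ← mul_assoc, this]
    exact key

theorem map_aux (φ : Hom L L') (s : L.H0) (j j' : L'.I) :
    res inf_le_left (φ.existsUnique_local s j).choose =
      L'.g j j' * res inf_le_right (φ.existsUnique_local s j').choose := by
  refine X.sheaf.eq_of_locally_eq' (fun i => (L'.U j ⊓ L'.U j') ⊓ L.U i) (L'.U j ⊓ L'.U j')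
    (fun i => homOfLE inf_le_left) ?_ _ _ ?_
  · rw [← inf_iSup_eq, L.cover, inf_top_eq]
  · intro i
    have e₁ := (φ.existsUnique_local s j).choose_spec.1 i
    have e₂ := (φ.existsUnique_local s j').choose_spec.1 i
    have h₁ : (L'.U j ⊓ L'.U j') ⊓ L.U i ≤ L'.U j ⊓ L.U i := inf_le_inf inf_le_left le_rfl
    have h₂ : (L'.U j ⊓ L'.U j') ⊓ L.U i ≤ L'.U j' ⊓ L.U i := inf_le_inf inf_le_right le_rfl
    have e₁' := congrArg (res h₁) e₁
    have e₂' := congrArg (res h₂) e₂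
    have := φ.compat j j' i i _ h₁ h₂ (le_inf inf_le_right inf_le_right) inf_le_left
    rw [L.g_self, map_one, mul_one] at this
    have key : res (inf_le_left : (L'.U j ⊓ L'.U j') ⊓ L.U i ≤ _)
          (res inf_le_left (φ.existsUnique_local s j).choose) =
        res inf_le_left
          (L'.g j j' * res inf_le_right (φ.existsUnique_local s j').choose) := by
      simp only [map_mul, res_res] at e₁' e₂' ⊢
      rw [e₁', e₂', this, mul_assoc]
    exact key

/-- The map `H⁰(L) → H⁰(L')` induced by a morphism of line bundles: the image of `s` is the
section whose restriction to `U' j ∩ U i` is `c j i * s i`. -/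
def map (φ : Hom L L') (s : L.H0) : L'.H0 :=
  ⟨fun j => (φ.existsUnique_local s j).choose, φ.map_aux s⟩

theorem map_spec (φ : Hom L L') (s : L.H0) (j : L'.I) (i : L.I) :
    res inf_le_left ((φ.map s).1 j) = φ.c j i * res inf_le_right (s.1 i) :=
  (φ.existsUnique_local s j).choose_spec.1 i

end Hom

theorem le_preimage_inf {Y : Scheme.{u}} (p : X ⟶ Y) (U V : Y.Opens) :
    p ⁻¹ᵁ U ⊓ p ⁻¹ᵁ V ≤ p ⁻¹ᵁ (U ⊓ V) := fun _ hx => hx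

theorem pull_compat {Y : Scheme.{u}} (p : X ⟶ Y) {L : LineBundle Y} (s : L.H0) (i j : L.I)
    (W : X.Opens) (hi : W ≤ p ⁻¹ᵁ L.U i) (hj : W ≤ p ⁻¹ᵁ L.U j)
    (hij : W ≤ p ⁻¹ᵁ (L.U i ⊓ L.U j)) :
    pull p hi (s.1 i) = pull p hij (L.g i j) * pull p hj (s.1 j) := by
  have := congrArg (pull p hij) (s.2 i j)
  simpa only [map_mul, pull_res] using this

theorem pull_g_mul {Y : Scheme.{u}} (p : X ⟶ Y) (L : LineBundle Y) (i j l : L.I)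
    (W : X.Opens) (hij : W ≤ p ⁻¹ᵁ (L.U i ⊓ L.U j)) (hjl : W ≤ p ⁻¹ᵁ (L.U j ⊓ L.U l))
    (hil : W ≤ p ⁻¹ᵁ (L.U i ⊓ L.U l)) :
    pull p hij (L.g i j) * pull p hjl (L.g j l) = pull p hil (L.g i l) := by
  have hW : W ≤ p ⁻¹ᵁ (L.U i ⊓ L.U j ⊓ L.U l) := fun x hx => ⟨hij hx, (hjl hx).2⟩
  have := congrArg (pull p hW) (L.g_mul i j l (L.U i ⊓ L.U j ⊓ L.U l) inf_le_left
    (le_inf (inf_le_left.trans inf_le_right) inf_le_right)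
    (le_inf (inf_le_left.trans inf_le_left) inf_le_right))
  simpa only [map_mul, pull_res] using this

/-- The pullback of a line bundle along a morphism of schemes. -/
def pullback {Y : Scheme.{u}} (p : X ⟶ Y) (L : LineBundle Y) : LineBundle X where
  I := L.I
  U i := p ⁻¹ᵁ L.U i
  cover := by rw [← Scheme.Hom.preimage_iSup, L.cover]; rfl
  g i j := pull p (U := L.U i ⊓ L.U j) (V := p ⁻¹ᵁ L.U i ⊓ p ⁻¹ᵁ L.U j)
    (le_preimage_inf p _ _) (L.g i j)
  g_self i := (congrArg _ (L.g_self i)).trans (map_one _)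
  g_mul i j l W h₁ h₂ h₃ := by
    rw [res_pull, res_pull, res_pull]
    exact pull_g_mul p L i j l W h₁ h₂ h₃

/-- The pullback of a section. -/
def pullbackSection {Y : Scheme.{u}} (p : X ⟶ Y) {L : LineBundle Y} (s : L.H0) :
    (L.pullback p).H0 :=
  ⟨fun i => pull p (U := L.U i) (V := p ⁻¹ᵁ L.U i) le_rfl (s.1 i), fun i j =>
    ((res_pull p _ _ _).trans (pull_compat p s i j (p ⁻¹ᵁ L.U i ⊓ p ⁻¹ᵁ L.U j) inf_le_left
      inf_le_right (le_preimage_inf p _ _))).trans (congrArg _ (res_pull p _ _ _).symm)⟩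

end LineBundle

/-! ### Effective divisors -/

/-- An effective (Cartier) divisor: local equations `f i` on an open cover, which are
nonzerodivisors, and any two of which agree up to a unit on overlaps. -/
structure EffectiveDivisor (X : Scheme.{u}) where
  I : Type u
  U : I → X.Opens
  cover : ⨆ i, U i = ⊤
  f : ∀ i, Γ(X, U i)
  regular : ∀ i (W : X.Opens) (h : W ≤ U i), res h (f i) ∈ nonZeroDivisors Γ(X, W)
  assoc : ∀ i j, Associated (res (inf_le_right : U i ⊓ U j ≤ U j) (f j))
    (res (inf_le_left : U i ⊓ U j ≤ U i) (f i))

namespace EffectiveDivisor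

variable {X : Scheme.{u}} (B : EffectiveDivisor X)

/-- The unit `f i / f j` on `U i ∩ U j`. -/
def ratio (i j : B.I) : Γ(X, B.U i ⊓ B.U j) := ((B.assoc i j).choose : Γ(X, B.U i ⊓ B.U j))

theorem ratio_spec (i j : B.I) :
    res inf_le_left (B.f i) = B.ratio i j * res inf_le_right (B.f j) := by
  rw [mul_comm]; exact (B.assoc i j).choose_spec.symm

theorem ratio_spec_res (i j : B.I) (W : X.Opens) (h : W ≤ B.U i ⊓ B.U j) :
    res (h.trans inf_le_left) (B.f i) =
      res h (B.ratio i j) * res (h.trans inf_le_right) (B.f j) := by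
  have := congrArg (res h) (B.ratio_spec i j)
  simpa only [map_mul, res_res] using this

/-- The line bundle `𝒪_X(B)`, with transition functions `f i / f j`. -/
def lineBundle : LineBundle X where
  I := B.I
  U := B.U
  cover := B.cover
  g := B.ratio
  g_self i := by
    have h := B.ratio_spec i i
    have hr := B.regular i (B.U i ⊓ B.U i) inf_le_left
    exact (mul_cancel_right_mem_nonZeroDivisors hr).1 (by rw [one_mul]; exact h.symm)
  g_mul i j l W h₁ h₂ h₃ := by
    have hr := B.regular l W (h₃.trans inf_le_right)
    refine (mul_cancel_right_mem_nonZeroDivisors hr).1 ?_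
    rw [mul_assoc, ← B.ratio_spec_res j l W h₂, ← B.ratio_spec_res i j W h₁,
      ← B.ratio_spec_res i l W h₃]

/-- The defining section `u ∈ H⁰(X, 𝒪_X(B))` of `B`. -/
def definingSection : B.lineBundle.H0 := ⟨B.f, B.ratio_spec⟩

end EffectiveDivisor

namespace LineBundle

variable {X : Scheme.{u}}

/-- The line bundle `L(-B) = L ⊗ 𝒪_X(B)⁻¹`. -/
def twistNeg (L : LineBundle X) (B : EffectiveDivisor X) : LineBundle X :=
  L.tensor B.lineBundle.dual

theorem mulDefiningSection_aux (L : LineBundle X) (B : EffectiveDivisor X) (j j' i i' : L.I)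
    (b b' : B.I) (W : X.Opens) (h : W ≤ L.U j ⊓ (L.U i ⊓ B.U b))
    (h' : W ≤ L.U j' ⊓ (L.U i' ⊓ B.U b')) (hi : W ≤ L.U i ⊓ B.U b ⊓ (L.U i' ⊓ B.U b'))
    (hj : W ≤ L.U j ⊓ L.U j') :
    res h (res (inf_le_inf le_rfl inf_le_left) (L.g j i) *
        res (inf_le_right.trans inf_le_right) (B.f b)) *
      res hi (res (inf_le_inf inf_le_left inf_le_left) (L.g i i') *
        res (inf_le_inf inf_le_right inf_le_right)
          (res (le_inf inf_le_right inf_le_left) (B.ratio b' b))) =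
    res hj (L.g j j') * res h' (res (inf_le_inf le_rfl inf_le_left) (L.g j' i') *
        res (inf_le_right.trans inf_le_right) (B.f b')) := by
  have hp : W ≤ L.U i ⊓ L.U i' := hi.trans (inf_le_inf inf_le_left inf_le_left)
  have hb : W ≤ B.U b' ⊓ B.U b :=
    le_inf ((hi.trans inf_le_right).trans inf_le_right)
      ((hi.trans inf_le_left).trans inf_le_right)
  have e₁ := L.g_mul j i i' W (h.trans (inf_le_inf le_rfl inf_le_left)) hp
    (le_inf (h.trans inf_le_left) (hp.trans inf_le_right))
  have e₂ := L.g_mul j j' i' W hj (h'.trans (inf_le_inf le_rfl inf_le_left))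
    (le_inf (h.trans inf_le_left) (hp.trans inf_le_right))
  have e₃ := B.ratio_spec_res b' b W hb
  simp only [map_mul, res_res]
  rw [e₃, ← mul_assoc, ← mul_assoc, ← mul_assoc, e₂, ← e₁]
  ring

/-- Multiplication `L(-B) ⟶ L` by the defining section `u` of `B`. -/
def mulDefiningSection (L : LineBundle X) (B : EffectiveDivisor X) : Hom (L.twistNeg B) L where
  c := fun (j : L.I) (p : L.I × B.I) =>
    (res (inf_le_inf le_rfl inf_le_left) (L.g j p.1) *
      res (inf_le_right.trans inf_le_right) (B.f p.2) : Γ(X, L.U j ⊓ (L.U p.1 ⊓ B.U p.2)))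
  compat j j' p p' W h h' hi hj :=
    L.mulDefiningSection_aux B j j' p.1 p'.1 p.2 p'.2 W h h' hi hj

end LineBundle

/-! ### Projective space and projective varieties -/

attribute [local instance] MvPolynomial.gradedAlgebra

/-- Projective space `ℙ^r = Proj k[x₀, …, x_r]`. -/
abbrev PSpace (k : Type u) [Field k] (r : ℕ) : Scheme.{u} :=
  Proj (MvPolynomial.homogeneousSubmodule (Fin (r + 1)) k)

namespace PSpace

variable (k : Type u) [Field k] (r : ℕ)

/-- The structure morphism `ℙ^r ⟶ Spec k`. -/
def toSpec : PSpace k r ⟶ Spec (.of k) :=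
  Proj.toSpecZero (MvPolynomial.homogeneousSubmodule (Fin (r + 1)) k) ≫
    Spec.map (CommRingCat.ofHom
      (algebraMap k (MvPolynomial.homogeneousSubmodule (Fin (r + 1)) k 0)))

/-- The standard open set `D₊(x_i)`. -/
abbrev chart (i : Fin (r + 1)) : (PSpace k r).Opens :=
  Proj.basicOpen (MvPolynomial.homogeneousSubmodule (Fin (r + 1)) k) (MvPolynomial.X i)

theorem iSup_chart : ⨆ i, chart k r i = ⊤ := by
  refine Proj.iSup_basicOpen_eq_top' _ _ (fun i => ⟨1, MvPolynomial.isHomogeneous_X _ _⟩) ?_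
  have h := MvPolynomial.adjoin_range_X (R := k) (σ := Fin (r + 1))
  rw [eq_top_iff]
  intro p _
  have hp : p ∈ Algebra.adjoin k (Set.range (MvPolynomial.X : Fin (r + 1) → _)) := by
    rw [h]; trivial
  induction hp using Algebra.adjoin_induction with
  | mem x hx => exact Algebra.subset_adjoin hx
  | algebraMap c =>
    exact Subalgebra.algebraMap_mem _
      (algebraMap k (MvPolynomial.homogeneousSubmodule (Fin (r + 1)) k 0) c)
  | add x y _ _ hx hy => exact add_mem (hx trivial) (hy trivial)
  | mul x y _ _ hx hy => exact mul_mem (hx trivial) (hy trivial)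

variable {k r}

theorem X_mem (i : Fin (r + 1)) :
    MvPolynomial.X i ∈ MvPolynomial.homogeneousSubmodule (Fin (r + 1)) k 1 :=
  MvPolynomial.isHomogeneous_X k i

/-- The regular function `l / x_i` on `D₊(x_i)`, for a linear form `l`. -/
def frac (i : Fin (r + 1)) (l : MvPolynomial (Fin (r + 1)) k)
    (hl : l ∈ MvPolynomial.homogeneousSubmodule (Fin (r + 1)) k 1) :
    Γ(PSpace k r, chart k r i) :=
  (Proj.awayToSection (MvPolynomial.homogeneousSubmodule (Fin (r + 1)) k)
      (MvPolynomial.X i)).hom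
    (HomogeneousLocalization.Away.mk _ (X_mem i) 1 l (by rwa [one_smul]))

theorem frac_apply (i : Fin (r + 1)) (l : MvPolynomial (Fin (r + 1)) k)
    (hl : l ∈ MvPolynomial.homogeneousSubmodule (Fin (r + 1)) k 1)
    (x : PSpace k r) (hx : x ∈ chart k r i) :
    ((frac i l hl).1 ⟨x, hx⟩).val = Localization.mk l ⟨MvPolynomial.X i, hx⟩ := by
  refine (ProjectiveSpectrum.Proj.awayToSection_apply _ _ _ _).trans ?_
  rw [HomogeneousLocalization.Away.val_mk, Localization.mk_eq_mk', IsLocalization.map_mk',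
    Localization.mk_eq_mk']
  simp only [RingHom.id_apply, pow_one]

theorem section_ext {U : (PSpace k r).Opens} (f g : Γ(PSpace k r, U))
    (h : ∀ x (hx : x ∈ U), (f.1 ⟨x, hx⟩).val = (g.1 ⟨x, hx⟩).val) : f = g :=
  Subtype.ext (funext fun x => HomogeneousLocalization.val_injective _ (h x.1 x.2))

theorem frac_self (i : Fin (r + 1)) : frac (k := k) i (MvPolynomial.X i) (X_mem i) = 1 := by
  refine section_ext _ _ fun x hx => ?_
  rw [frac_apply]
  have := x.isPrime
  refine (Localization.mk_self
    (⟨MvPolynomial.X i, hx⟩ : x.asHomogeneousIdeal.toIdeal.primeCompl)).trans ?_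
  exact HomogeneousLocalization.val_one.symm

theorem frac_mul (i j : Fin (r + 1)) (l : MvPolynomial (Fin (r + 1)) k)
    (hl : l ∈ MvPolynomial.homogeneousSubmodule (Fin (r + 1)) k 1)
    (W : (PSpace k r).Opens) (hi : W ≤ chart k r i) (hj : W ≤ chart k r j) :
    res hi (frac i (MvPolynomial.X j) (X_mem j)) * res hj (frac j l hl) =
      res hi (frac i l hl) := by
  refine section_ext _ _ fun x hx => ?_
  have e₁ := frac_apply i (MvPolynomial.X j) (X_mem j) x (hi hx)
  have e₂ := frac_apply j l hl x (hj hx)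
  have e₃ := frac_apply i l hl x (hi hx)
  refine Eq.trans (HomogeneousLocalization.val_mul _ _) ?_
  refine (congrArg₂ (· * ·) e₁ e₂).trans (Eq.trans ?_ e₃.symm)
  change Localization.mk _ _ * Localization.mk _ _ = _
  rw [Localization.mk_mul, Localization.mk_eq_mk_iff, Localization.r_iff_exists]
  refine ⟨1, ?_⟩
  simp only [Submonoid.coe_mul, OneMemClass.coe_one, one_mul]
  ring

variable (k r) in
/-- The line bundle `𝒪(1)` on `ℙ^r`, with transition functions `x_j / x_i` on
`D₊(x_i) ∩ D₊(x_j)`. -/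
def O1 : LineBundle (PSpace k r) where
  I := ULift.{u} (Fin (r + 1))
  U i := chart k r i.down
  cover := by
    rw [← iSup_chart k r]
    exact Equiv.ulift.iSup_congr (fun _ => rfl)
  g i j := res inf_le_left
    (frac i.down (MvPolynomial.X j.down) (X_mem j.down))
  g_self i := by rw [frac_self, map_one]
  g_mul i j l W h₁ h₂ h₃ := by
    simp only [res_res]
    exact frac_mul i.down j.down _ _ W _ _

/-- The section of `𝒪(1)` given by a linear form `l`; on `D₊(x_i)` it is `l / x_i`. -/
def linearSection (l : MvPolynomial (Fin (r + 1)) k)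
    (hl : l ∈ MvPolynomial.homogeneousSubmodule (Fin (r + 1)) k 1) : (O1 k r).H0 :=
  ⟨fun i => frac i.down l hl, fun i j => by
    simp only [O1]
    exact (frac_mul i.down j.down l hl _ _ _).symm⟩

end PSpace

/-- A projective variety `X ⊆ ℙ^r`: an irreducible and reduced closed subscheme. -/
structure ProjectiveVariety (k : Type u) [Field k] (r : ℕ) where
  carrier : Scheme.{u}
  emb : carrier ⟶ PSpace k r
  isClosedImmersion : IsClosedImmersion emb
  isIntegral : AlgebraicGeometry.IsIntegral carrier

namespace ProjectiveVariety

variable {k : Type u} [Field k] {r : ℕ} (X : ProjectiveVariety k r)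

instance : X.carrier.Over (Spec (.of k)) := ⟨X.emb ≫ PSpace.toSpec k r⟩

/-- `X` is smooth over `k`. -/
def IsSmooth : Prop := Smooth (X.carrier ↘ Spec (.of k))

/-- The homogeneous ideal `I_X` of `X`. -/
def ideal : Ideal (MvPolynomial (Fin (r + 1)) k) :=
  (ProjectiveSpectrum.vanishingIdeal
    (𝒜 := MvPolynomial.homogeneousSubmodule (Fin (r + 1)) k) (Set.range X.emb)).toIdeal

/-- `X` is nondegenerate: it is contained in no hyperplane. -/
def IsNondegenerate : Prop :=
  ∀ l ∈ MvPolynomial.homogeneousSubmodule (Fin (r + 1)) k 1, l ∈ X.ideal → l = 0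

/-- The line bundle `𝒪_X(1)`. -/
def O1 : LineBundle X.carrier := (PSpace.O1 k r).pullback X.emb

/-- The restriction to `X` of a linear form, as a global section of `𝒪_X(1)`. -/
def restrictLinear (l : MvPolynomial (Fin (r + 1)) k)
    (hl : l ∈ MvPolynomial.homogeneousSubmodule (Fin (r + 1)) k 1) : X.O1.H0 :=
  LineBundle.pullbackSection X.emb (PSpace.linearSection l hl)

end ProjectiveVariety

/-! ### Linear matrices -/

/-- A linear matrix: all entries are linear forms. -/
def IsLinearMatrix {k : Type u} [Field k] {r a b : ℕ}
    (M : Matrix (Fin a) (Fin b) (MvPolynomial (Fin (r + 1)) k)) : Prop :=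
  ∀ i j, M i j ∈ MvPolynomial.homogeneousSubmodule (Fin (r + 1)) k 1

/-- A matrix `M` is `1`-generic if `A M Bᵀ` has no zero entry for all invertible scalar
matrices `A`, `B`. -/
def IsOneGeneric {k : Type u} [Field k] {r a b : ℕ}
    (M : Matrix (Fin a) (Fin b) (MvPolynomial (Fin (r + 1)) k)) : Prop :=
  ∀ (A : GL (Fin a) k) (B : GL (Fin b) k) (i : Fin a) (j : Fin b),
    ((A.1.map (MvPolynomial.C (σ := Fin (r + 1))) * M) *
      (B.1.map (MvPolynomial.C (σ := Fin (r + 1)))).transpose) i j ≠ 0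

/-- The ideal `I_s(M)` generated by the `s`-minors of `M`. -/
def minorIdeal {R : Type u} [CommRing R] {a b : ℕ} (s : ℕ) (M : Matrix (Fin a) (Fin b) R) :
    Ideal R :=
  Ideal.span {d | ∃ (p : Fin s ↪o Fin a) (q : Fin s ↪o Fin b), d = (M.submatrix p q).det}

end DetPres

end

/-! The argument takes place in the function field `K` of `X`. Dividing by `x₀` turns the entries of
`M` into rational functions `m i j`. By 1-genericity no form `cᵀ M d` with `c, d ≠ 0` is zero, and
by nondegeneracy it stays nonzero on `X`. The 2-minors say that `m` has rank one, so `m i j = v i *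
w j` with `v i = m i 0 / m 0 0` and `w j = m 0 j`.

The line bundle `L₁` comes from dividing `v` locally by a greatest common divisor. Over a factorial
local ring `O` some `d ∈ K` makes `v / d` primitive, meaning `(O : v / d) = O`. Two proportional
primitive vectors differ by a unit, and primitivity persists in a neighbourhood, so the local `d`
form the frame of a line bundle of which the `v i` become sections (`exists_frame_isPrimitive`). At
a point of codimension one a primitive vector has a unit entry, so there is no fixed component
(`IsPrimitive.exists_isUnit`). The same applied to `w` gives `L₂`. The product of the two local
divisors, compared with a frame of `𝒪_X(1)`, is a regular function `q`: primitivity of `v` and then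
of `w` deduces this from regularity of all entries. The functions `q` are the equations of `B`
(`Frame.IsPrimitive.exists_divisor`). If `M` is symmetric, then `w = m 0 0 * v`, and multiplication
by `m 0 0` is an isomorphism `L₁ ≅ L₂` (`Frame.IsPrimitive.exists_hasScale_isIso`).

The algebraic input is the factoriality of the local ring `A` of a smooth variety at a closed point
(`UniqueFactorizationMonoid.of_formallySmooth`). Formal smoothness lifts the first-order Taylor
expansion to a map from `A` to a power series ring over `k` that behaves like a completion. Power
series rings are factorial by Weierstrass preparation and induction on the number of variables, and
factoriality descends to `A` by Artin–Rees and Krull's intersection theorem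
(`UniqueFactorizationMonoid.of_completion`). Both steps rest on the criterion that a noetherian
domain is factorial once every `(a) : (b)` with `a ≠ 0` is principal. -/

section

/-! ### Principal colon ideals as a criterion for factoriality. -/

open scoped Polynomial

/-- The ideal quotient `(a) : (b)` is principal. -/
def HasPrincipalColon {R : Type*} [CommRing R] (a b : R) : Prop :=
  ∃ y, ∀ c, a ∣ c * b ↔ y ∣ c

theorem HasPrincipalColon.of_ringEquiv {R S : Type*} [CommRing R] [CommRing S] (e : R ≃+* S)
    {a b : R} (h : HasPrincipalColon (e a) (e b)) : HasPrincipalColon a b := by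
  obtain ⟨y, hy⟩ := h
  refine ⟨e.symm y, fun c => ?_⟩
  rw [← map_dvd_iff e, map_mul, hy, ← map_dvd_iff e (a := e.symm y), e.apply_symm_apply]

theorem HasPrincipalColon.of_associated {R : Type*} [CommRing R] {a a' b b' : R}
    (ha : Associated a a') (hb : a' ∣ b - b') (h : HasPrincipalColon a' b') :
    HasPrincipalColon a b := by
  obtain ⟨y, hy⟩ := h
  refine ⟨y, fun c => ?_⟩
  rw [← hy, ha.dvd_iff_dvd_left]
  have : c * b = c * b' + c * (b - b') := by ring
  rw [this]
  exact (dvd_add_left (hb.mul_left c))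

theorem UniqueFactorizationMonoid.hasPrincipalColon {R : Type*} [CommRing R] [IsDomain R]
    [UniqueFactorizationMonoid R] (a b : R) : HasPrincipalColon a b := by
  classical
  let _ : GCDMonoid R := UniqueFactorizationMonoid.toGCDMonoid R
  by_cases hb : b = 0
  · exact ⟨1, fun c => by simp [hb]⟩
  obtain ⟨y, hy⟩ := dvd_lcm_right a b
  refine ⟨y, fun c => ?_⟩
  conv_rhs => rw [← mul_dvd_mul_iff_left hb, ← hy, lcm_dvd_iff, mul_comm b c]
  exact ⟨fun h => ⟨h, dvd_mul_left _ _⟩, fun h => h.1⟩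

/-- If `y` generates `(a) : (b)`, then `y * b` is a least common multiple of `a` and `b`. Least
common multiples give greatest common divisors, and these together with the ascending chain
condition give factoriality. -/
theorem UniqueFactorizationMonoid.of_hasPrincipalColon {R : Type*} [CommRing R] [IsDomain R]
    [IsNoetherianRing R] (h : ∀ a b : R, a ≠ 0 → HasPrincipalColon a b) :
    UniqueFactorizationMonoid R := by
  classical
  have key : ∀ a b : R, ∃ c, ∀ d, a ∣ d ∧ b ∣ d ↔ c ∣ d := by
    intro a b
    by_cases ha : a = 0
    · exact ⟨0, fun d => by rw [ha]; exact ⟨fun h => h.1, fun h => ⟨h, by rw [zero_dvd_iff.1 h]; exact dvd_zero _⟩⟩⟩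
    · obtain ⟨y, hy⟩ := h a b ha
      refine ⟨y * b, fun d => ⟨?_, fun hd => ⟨?_, (dvd_mul_left b y).trans hd⟩⟩⟩
      · rintro ⟨h1, c, rfl⟩
        rw [mul_comm b c] at h1 ⊢
        exact mul_dvd_mul_right ((hy c).1 h1) b
      · exact ((hy y).2 dvd_rfl).trans hd
  let _ : GCDMonoid R := gcdMonoidOfExistsLCM key
  exact ufm_of_decomposition_of_wfDvdMonoid

/-! ### Colon ideals in one variable via Weierstrass preparation. -/

namespace PowerSeries

open IsLocalRing in
-- Up to a unit `g` is a distinguished polynomial `f`, and `A[X]/(f) → A⟦X⟧/(f)` is an isomorphism.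
-- The colon ideal can therefore be computed in `A[X]`, which is factorial by Gauss's lemma.
theorem hasPrincipalColon_of_map_residue_ne_zero {A : Type*} [CommRing A] [IsDomain A]
    [IsLocalRing A] [UniqueFactorizationMonoid A] [IsAdicComplete (maximalIdeal A) A]
    {g : A⟦X⟧} (hg : g.map (residue A) ≠ 0) (b : A⟦X⟧) : HasPrincipalColon g b := by
  obtain ⟨f, h, H⟩ := exists_isWeierstrassFactorization hg
  have hgf : Associated g (f : A⟦X⟧) := by
    obtain ⟨u, hu⟩ := H.isUnit
    exact Associated.symm ⟨u, by rw [hu, H.eq_mul]⟩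
  -- Injectivity of `A[X]/(f) → A⟦X⟧/(f)`; `hrem` below is surjectivity.
  have hdvd : ∀ p : A[X], (f : A⟦X⟧) ∣ (p : A⟦X⟧) ↔ f ∣ p := by
    intro p
    constructor
    · intro hp
      have h0 : H.isDistinguishedAt.algEquivQuotient (Ideal.Quotient.mk _ p) = 0 := by
        have : H.isDistinguishedAt.algEquivQuotient (Ideal.Quotient.mk _ p) =
          Ideal.Quotient.mk _ (p : A⟦X⟧) := rfl
        rw [this, Ideal.Quotient.eq_zero_iff_mem, Ideal.mem_span_singleton]
        exact hp
      rw [EmbeddingLike.map_eq_zero_iff, Ideal.Quotient.eq_zero_iff_mem,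
        Ideal.mem_span_singleton] at h0
      exact h0
    · rintro ⟨q, rfl⟩
      exact ⟨q, by simp⟩
  have hrem : ∀ b : A⟦X⟧, ∃ p : A[X], (f : A⟦X⟧) ∣ b - p := by
    intro b
    obtain ⟨x, hx⟩ := H.isDistinguishedAt.algEquivQuotient.surjective (Ideal.Quotient.mk _ b)
    obtain ⟨p, rfl⟩ := Ideal.Quotient.mk_surjective x
    refine ⟨p, ?_⟩
    have : Ideal.Quotient.mk (Ideal.span {(f : A⟦X⟧)}) (p : A⟦X⟧) = Ideal.Quotient.mk _ b := hx
    rw [← Ideal.mem_span_singleton, ← Ideal.Quotient.eq, this]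
  obtain ⟨p, hp⟩ := hrem b
  refine HasPrincipalColon.of_associated hgf hp ?_
  obtain ⟨y, hy⟩ := UniqueFactorizationMonoid.hasPrincipalColon f p
  -- Because `y` divides `f`, divisibility of a power series by `y` depends only on its remainder
  -- modulo `f`.
  have hyf : y ∣ f := (hy f).1 (dvd_mul_right f p)
  have hyf' : (y : A⟦X⟧) ∣ (f : A⟦X⟧) := by
    obtain ⟨q, rfl⟩ := hyf
    exact ⟨q, by simp⟩
  refine ⟨y, fun c => ?_⟩
  obtain ⟨q, hq⟩ := hrem c
  have e1 : (f : A⟦X⟧) ∣ c * p ↔ f ∣ q * p := by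
    rw [← hdvd, Polynomial.coe_mul]
    have : c * (p : A⟦X⟧) = q * p + (c - q) * p := by ring
    rw [this]
    exact dvd_add_left (hq.mul_right _)
  have e2 : (y : A⟦X⟧) ∣ c ↔ (y : A⟦X⟧) ∣ q := by
    simpa using dvd_add_left (b := (q : A⟦X⟧)) (hyf'.trans hq)
  rw [e1, hy, e2]
  constructor
  · rintro ⟨z, rfl⟩
    exact ⟨z, by simp⟩
  · intro hz
    refine (hy q).1 ?_
    rw [← hdvd, Polynomial.coe_mul]
    have h1 : (f : A⟦X⟧) ∣ (y : A⟦X⟧) * p := by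
      rw [← Polynomial.coe_mul, hdvd]; exact (hy y).2 dvd_rfl
    exact h1.trans (mul_dvd_mul_right hz _)

end PowerSeries

/-! ### Factoriality of power series rings over an infinite field. -/

namespace MvPowerSeries

variable {k : Type*} [Field k] {n : ℕ}

/-- Each monomial of `f` is assigned to the first variable occurring in it, and `g i` collects those
assigned to `X i`, divided by `X i`. The degree drops by exactly one. -/
theorem exists_eq_sum_X_mul_of_lt_order (f : MvPowerSeries (Fin n) k) (m : ℕ)
    (hf : (m + 1 : ℕ) ≤ f.order) :
    ∃ g : Fin n → MvPowerSeries (Fin n) k, f = ∑ i, X i * g i ∧ ∀ i, (m : ℕ∞) ≤ (g i).order := by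
  classical
  obtain ⟨g, hg⟩ : ∃ g : Fin n → MvPowerSeries (Fin n) k, ∀ i d, coeff d (g i) =
      if ∀ j < i, d j = 0 then coeff (d + Finsupp.single i 1) f else 0 :=
    ⟨fun i d => if ∀ j < i, d j = 0 then coeff (d + Finsupp.single i 1) f else 0,
      fun i d => rfl⟩
  refine ⟨g, ?_, ?_⟩
  · ext e
    rw [map_sum]
    by_cases he : e = 0
    · subst he
      rw [coeff_of_lt_order (by rw [map_zero]; exact lt_of_lt_of_le (by norm_cast; omega) hf)]
      refine (Finset.sum_eq_zero fun i _ => ?_).symm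
      simp
    · have hex : ∃ i, e i ≠ 0 := by
        by_contra! h
        exact he (Finsupp.ext h)
      obtain ⟨i, hi, hmin⟩ : ∃ i, e i ≠ 0 ∧ ∀ j < i, e j = 0 := by
        have hne : (Finset.univ.filter fun i => e i ≠ 0).Nonempty := by
          obtain ⟨i, hi⟩ := hex
          exact ⟨i, by simpa using hi⟩
        refine ⟨_, (Finset.mem_filter.1 (Finset.min'_mem _ hne)).2, fun j hj => ?_⟩
        by_contra h
        exact absurd hj (not_lt.2 (Finset.min'_le _ _ (by simpa using h)))
      have hX : ∀ (l : Fin n) (g : MvPowerSeries (Fin n) k), coeff e (X l * g) =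
          if e l ≠ 0 then coeff (e - Finsupp.single l 1) g else 0 := by
        intro l g
        rw [X, coeff_monomial_mul]
        simp [Finsupp.single_le_iff, Nat.one_le_iff_ne_zero]
      rw [Finset.sum_eq_single i]
      · rw [hX, if_pos hi]
        have h1 : e - Finsupp.single i 1 + Finsupp.single i 1 = e :=
          tsub_add_cancel_of_le (by simpa [Finsupp.single_le_iff, Nat.one_le_iff_ne_zero] using hi)
        rw [hg, if_pos, h1]
        intro j hj
        simp [hmin j hj]
      · intro l _ hl
        rw [hX]
        split_ifs with h
        · rw [hg, if_neg]
          intro hall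
          rcases lt_trichotomy l i with h' | h' | h'
          · exact h (hmin l h')
          · exact hl h'
          · have := hall i h'
            simp [hl] at this
            exact hi this
        · rfl
      · simp
  · intro i
    refine nat_le_order fun d hd => ?_
    rw [hg]
    split_ifs
    · refine coeff_of_lt_order (lt_of_lt_of_le ?_ hf)
      rw [map_add, Finsupp.degree_single]
      exact_mod_cast Nat.add_lt_add_right hd 1
    · rfl

variable (k n) in
/-- The ideal generated by the variables. -/
noncomputable abbrev varIdeal : Ideal (MvPowerSeries (Fin n) k) := Ideal.span (Set.range X)

theorem mem_varIdeal_pow_of_le_order (m : ℕ) (f : MvPowerSeries (Fin n) k)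
    (hf : (m : ℕ∞) ≤ f.order) : f ∈ varIdeal k n ^ m := by
  induction m generalizing f with
  | zero => simp
  | succ m ih =>
    obtain ⟨g, rfl, hg⟩ := exists_eq_sum_X_mul_of_lt_order f m hf
    refine Ideal.sum_mem _ fun i _ => ?_
    rw [pow_succ']
    exact Ideal.mul_mem_mul (Ideal.subset_span ⟨i, rfl⟩) (ih _ (hg i))

theorem le_order_of_mem_varIdeal_pow (m : ℕ) (f : MvPowerSeries (Fin n) k)
    (hf : f ∈ varIdeal k n ^ m) : (m : ℕ∞) ≤ f.order := by
  induction m generalizing f with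
  | zero => simp
  | succ m ih =>
    rw [pow_succ] at hf
    induction hf using Submodule.mul_induction_on' with
    | mem_mul_mem a ha b hb =>
      refine le_trans ?_ le_order_mul
      rw [Nat.cast_add, Nat.cast_one]
      refine add_le_add (ih a ha) ?_
      rw [one_le_order_iff_constCoeff_eq_zero]
      change b ∈ RingHom.ker (constantCoeff (σ := Fin n) (R := k))
      refine (Ideal.span_le.2 ?_) hb
      rintro _ ⟨i, rfl⟩
      simp
    | add a _ b _ ha hb => exact (le_min ha hb).trans min_order_le_add

theorem mem_varIdeal_pow_iff (m : ℕ) (f : MvPowerSeries (Fin n) k) :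
    f ∈ varIdeal k n ^ m ↔ (m : ℕ∞) ≤ f.order :=
  ⟨le_order_of_mem_varIdeal_pow m f, mem_varIdeal_pow_of_le_order m f⟩

theorem maximalIdeal_eq_varIdeal :
    IsLocalRing.maximalIdeal (MvPowerSeries (Fin n) k) = varIdeal k n := by
  ext f
  rw [IsLocalRing.mem_maximalIdeal, mem_nonunits_iff, isUnit_iff_constantCoeff,
    isUnit_iff_ne_zero, not_not, ← one_le_order_iff_constCoeff_eq_zero]
  simpa using (mem_varIdeal_pow_iff 1 f).symm

instance isAdicComplete_maximalIdeal :
    IsAdicComplete (IsLocalRing.maximalIdeal (MvPowerSeries (Fin n) k))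
      (MvPowerSeries (Fin n) k) := by
  rw [maximalIdeal_eq_varIdeal]
  infer_instance

/-- Restriction of a power series to the first coordinate axis. -/
noncomputable def axisRestriction : MvPowerSeries (Fin (n + 1)) k →+* PowerSeries k :=
  (PowerSeries.map constantCoeff).comp (finSuccEquiv k n).toRingEquiv.toRingHom

theorem coeff_axisRestriction (f : MvPowerSeries (Fin (n + 1)) k) (d : ℕ) :
    PowerSeries.coeff d (axisRestriction f) = coeff (Finsupp.cons d 0) f := by
  rw [← coeff_coeff_finSuccEquiv]
  rfl

/-- The residue map of the coefficient ring kills exactly the series with zero constant coefficient.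
So a series that does not vanish on the first axis satisfies the hypothesis of Weierstrass
preparation. -/
theorem map_residue_finSuccEquiv_ne_zero (f : MvPowerSeries (Fin (n + 1)) k)
    (hf : axisRestriction f ≠ 0) :
    (finSuccEquiv k n f).map (IsLocalRing.residue (MvPowerSeries (Fin n) k)) ≠ 0 := by
  intro h
  apply hf
  ext d
  have h1 := congrArg (PowerSeries.coeff d) h
  rw [PowerSeries.coeff_map, map_zero, IsLocalRing.residue_eq_zero_iff,
    IsLocalRing.mem_maximalIdeal, mem_nonunits_iff, isUnit_iff_constantCoeff,
    isUnit_iff_ne_zero, not_not] at h1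
  exact h1

/-- The images of the variables under a linear coordinate change. -/
noncomputable def shear (c : Fin (n + 1) → k) : Fin (n + 1) → MvPowerSeries (Fin (n + 1)) k :=
  Fin.cons (C (c 0) * X 0) fun i => X i.succ + C (c i.succ) * X 0

theorem shear_zero (c : Fin (n + 1) → k) : shear c 0 = C (c 0) * X 0 := rfl

theorem shear_succ (c : Fin (n + 1) → k) (i : Fin n) :
    shear c i.succ = X i.succ + C (c i.succ) * X 0 := rfl

theorem constantCoeff_shear (c : Fin (n + 1) → k) (i : Fin (n + 1)) :
    constantCoeff (shear c i) = 0 := by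
  refine Fin.cases ?_ (fun j => ?_) i <;> simp [shear_zero, shear_succ]

theorem hasSubst_shear (c : Fin (n + 1) → k) : HasSubst (shear c) :=
  hasSubst_of_constantCoeff_zero (constantCoeff_shear c)

theorem substAlgHom_shear_comp (c c' : Fin (n + 1) → k) (h0 : c 0 * c' 0 = 1)
    (h : ∀ i : Fin n, c i.succ * c' 0 + c' i.succ = 0) (f : MvPowerSeries (Fin (n + 1)) k) :
    subst (shear c') (subst (shear c) f) = f := by
  rw [subst_comp_subst_apply (hasSubst_shear c) (hasSubst_shear c')]
  have : (fun s => subst (shear c') (shear c s)) = (X : Fin (n + 1) → MvPowerSeries _ k) := by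
    funext s
    rw [← substAlgHom_apply (hasSubst_shear c')]
    have hC : ∀ r : k, substAlgHom (R := k) (hasSubst_shear c') (C r) = C r := fun r => by
      rw [substAlgHom_apply]; exact subst_C _
    refine Fin.cases ?_ (fun j => ?_) s
    · rw [shear_zero]
      rw [map_mul, hC, substAlgHom_X]
      rw [shear_zero]
      rw [← mul_assoc, ← map_mul, h0, map_one, one_mul]
    · rw [shear_succ]
      rw [map_add, map_mul, hC, substAlgHom_X, substAlgHom_X]
      rw [shear_zero, shear_succ]
      rw [← mul_assoc, ← map_mul, add_assoc, ← add_mul, ← map_add, add_comm (c' _), h, map_zero,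
        zero_mul, add_zero]
  rw [this, subst_self, id]

/-- The coordinate change given by `shear`. -/
noncomputable def shearEquiv (c : Fin (n + 1) → k) (h0 : c 0 ≠ 0) :
    MvPowerSeries (Fin (n + 1)) k ≃+* MvPowerSeries (Fin (n + 1)) k where
  toFun := subst (shear c)
  invFun := subst (shear (Fin.cons (c 0)⁻¹ fun i => - c i.succ * (c 0)⁻¹))
  left_inv f := substAlgHom_shear_comp _ _ (by simp [h0]) (by simp) f
  right_inv f := substAlgHom_shear_comp _ _ (by simp [h0]) (by simp [h0]) f
  map_mul' := subst_mul (hasSubst_shear c)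
  map_add' := subst_add (hasSubst_shear c)

theorem coeff_axisRestriction_of_lt_order (f : MvPowerSeries (Fin (n + 1)) k) (d : ℕ)
    (h : d < f.order) : PowerSeries.coeff d (axisRestriction f) = 0 := by
  rw [coeff_axisRestriction]
  refine coeff_of_lt_order ?_
  have : Finsupp.degree (Finsupp.cons d (0 : Fin n →₀ ℕ)) = d := by
    simp [Finsupp.degree_eq_sum, Fin.sum_univ_succ]
  rwa [this]

theorem axisRestriction_C (r : k) :
    axisRestriction (n := n) (C r) = PowerSeries.C r := by
  have : axisRestriction (n := n) (C r) =
    PowerSeries.map constantCoeff (finSuccEquiv k n (C r)) := rfl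
  simp [this]

theorem axisRestriction_shear (c : Fin (n + 1) → k) (i : Fin (n + 1)) :
    axisRestriction (shear c i) = PowerSeries.C (c i) * PowerSeries.X := by
  have h0 : axisRestriction (n := n) (k := k) (X 0) = PowerSeries.X := by
    have : axisRestriction (n := n) (k := k) (X 0) =
      PowerSeries.map constantCoeff (finSuccEquiv k n (X 0)) := rfl
    simp [this]
  refine Fin.cases ?_ (fun j => ?_) i
  · rw [shear_zero]
    rw [map_mul, axisRestriction_C, h0]
  · have hj : axisRestriction (n := n) (k := k) (X j.succ) = 0 := by
      have : axisRestriction (n := n) (k := k) (X j.succ) =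
        PowerSeries.map constantCoeff (finSuccEquiv k n (X j.succ)) := rfl
      rw [this, finSuccEquiv_X_succ, PowerSeries.map_C]
      simp
    rw [shear_succ]
    rw [map_add, map_mul, axisRestriction_C, h0, hj, zero_add]

/-- The shear carries the first axis to the line `t ↦ t • c`, on which a form of degree `d` is its
value at `c` times `t ^ d`. -/
theorem axisRestriction_aeval_shear (c : Fin (n + 1) → k) (p : MvPolynomial (Fin (n + 1)) k)
    (d : ℕ) (hp : p.IsHomogeneous d) :
    axisRestriction (MvPolynomial.aeval (shear c) p) =
      PowerSeries.C (MvPolynomial.eval c p) * PowerSeries.X ^ d := by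
  rw [MvPolynomial.aeval_def, MvPolynomial.eval₂_eq', MvPolynomial.eval_eq', map_sum, map_sum,
    Finset.sum_mul]
  refine Finset.sum_congr rfl fun e he => ?_
  have hd : ∑ i, e i = d := by
    have := hp (MvPolynomial.mem_support_iff.1 he)
    rw [← this, Finsupp.weight_apply, Finsupp.sum_fintype _ _ (by simp)]
    simp
  have hC : algebraMap k (MvPowerSeries (Fin (n + 1)) k) = C := rfl
  rw [map_mul, hC, axisRestriction_C, map_prod, map_mul, map_prod]
  simp only [map_pow, axisRestriction_shear, mul_pow]
  rw [Finset.prod_mul_distrib, Finset.prod_pow_eq_pow_sum, hd, mul_assoc]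

/-- Over an infinite field the initial form `p` of `f` is nonzero at some `c`. After the shear along
`c`, the coefficient of `t ^ d` on the axis is `p(c)`. -/
theorem exists_shear_axisRestriction_ne_zero [Infinite k] (f : MvPowerSeries (Fin (n + 1)) k)
    (hf : f ≠ 0) : ∃ (c : Fin (n + 1) → k) (h0 : c 0 ≠ 0),
      axisRestriction (shearEquiv c h0 f) ≠ 0 := by
  obtain ⟨d, hd⟩ : ∃ d : ℕ, f.order = d := ⟨_, (ne_zero_iff_order_finite.1 hf).symm⟩
  -- Truncating to degrees below `d + 1` leaves only the part of degree `d`, since `f` has order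
  -- `d`.
  set p := truncTotal (d + 1) f with hp
  have hhom : p.IsHomogeneous d := by
    intro e he
    rw [Finsupp.weight_apply, Finsupp.sum_fintype _ _ (by simp)]
    have hdeg : ∑ i, e i • (1 : Fin (n + 1) → ℕ) i = Finsupp.degree e := by
      simp [Finsupp.degree_eq_sum]
    rw [hdeg]
    by_contra hne
    apply he
    rcases lt_or_gt_of_ne hne with h | h
    · rw [hp, coeff_truncTotal _ (by omega)]
      exact coeff_of_lt_order (by rw [hd]; exact_mod_cast h)
    · rw [hp]
      exact coeff_truncTotal_eq_zero _ (by omega)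
  have hfp : ((d + 1 : ℕ) : ℕ∞) ≤ (f - (p : MvPowerSeries (Fin (n + 1)) k)).order := by
    refine nat_le_order fun e he => ?_
    rw [map_sub, MvPolynomial.coeff_coe, hp, coeff_truncTotal _ he, sub_self]
  have hp0 : p ≠ 0 := by
    intro h0
    rw [h0, MvPolynomial.coe_zero, sub_zero, hd] at hfp
    exact absurd hfp (by norm_cast; omega)
  -- The extra factor `X 0` forces `c 0 ≠ 0`, which makes the shear invertible.
  obtain ⟨c, hc⟩ : ∃ c, MvPolynomial.eval c (p * MvPolynomial.X 0) ≠ 0 := by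
    by_contra! h
    exact mul_ne_zero hp0 (MvPolynomial.X_ne_zero 0) (MvPolynomial.funext (by simpa using h))
  rw [map_mul, MvPolynomial.eval_X] at hc
  refine ⟨c, right_ne_zero_of_mul hc, fun h => ?_⟩
  have h1 : shearEquiv c (right_ne_zero_of_mul hc) f =
      MvPolynomial.aeval (shear c) p + subst (shear c) (f - (p : MvPowerSeries (Fin (n + 1)) k)) := by
    rw [← subst_coe p, ← subst_add (hasSubst_shear c), add_sub_cancel]
    rfl
  have h2 : ((d + 1 : ℕ) : ℕ∞) ≤ (subst (shear c) (f - (p : MvPowerSeries (Fin (n + 1)) k))).order := by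
    refine le_trans ?_ (le_order_subst (hasSubst_shear c) _)
    refine hfp.trans ?_
    conv_lhs => rw [← one_mul (f - (p : MvPowerSeries (Fin (n + 1)) k)).order]
    gcongr
    exact le_iInf fun i => one_le_order_iff_constCoeff_eq_zero.2 (constantCoeff_shear c i)
  have h3 := congrArg (PowerSeries.coeff d) h
  rw [h1, map_add, map_add, axisRestriction_aeval_shear c p d hhom,
    coeff_axisRestriction_of_lt_order _ _ (lt_of_lt_of_le (by norm_cast; omega) h2), add_zero,
    PowerSeries.coeff_C_mul_X_pow, if_pos rfl, map_zero] at h3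
  exact left_ne_zero_of_mul hc h3

instance uniqueFactorizationMonoid [Infinite k] :
    UniqueFactorizationMonoid (MvPowerSeries (Fin n) k) := by
  induction n with
  | zero =>
    exact (isEmptyEquiv (Fin 0) k).toMulEquiv.symm.uniqueFactorizationMonoid inferInstance
  | succ n ih =>
    have hdom (m : ℕ) : IsDomain (MvPowerSeries (Fin m) k) := NoZeroDivisors.to_isDomain _
    refine UniqueFactorizationMonoid.of_hasPrincipalColon fun a b ha => ?_
    -- After the shear Weierstrass preparation applies over the power series ring in one variable
    -- fewer, which is factorial by `ih`.
    obtain ⟨c, h0, hc⟩ := exists_shear_axisRestriction_ne_zero a ha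
    refine HasPrincipalColon.of_ringEquiv ((shearEquiv c h0).trans (finSuccEquiv k n).toRingEquiv) ?_
    exact PowerSeries.hasPrincipalColon_of_map_residue_ne_zero
      (map_residue_finSuccEquiv_ne_zero _ hc) _

end MvPowerSeries

end

/-! ### Adic completeness, and descent of factoriality from a completion. -/

theorem IsAdicComplete.pow {R : Type*} [CommRing R] {I : Ideal R} [IsAdicComplete I R]
    (e : ℕ) (he : 0 < e) : IsAdicComplete (I ^ e) R where
  haus' x hx := by
    refine IsHausdorff.haus (I := I) inferInstance x fun n => ?_
    refine (hx n).mono ?_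
    rw [← pow_mul]
    exact Submodule.smul_mono_left (Ideal.pow_le_pow_right (Nat.le_mul_of_pos_left n he))
  prec' f hf := by
    have hle : ∀ n, n ≤ e * n := fun n => Nat.le_mul_of_pos_left n he
    obtain ⟨L, hL⟩ := IsPrecomplete.prec (I := I) inferInstance (f := f) fun {m n} hmn => by
      refine (hf hmn).mono ?_
      rw [← pow_mul]
      exact Submodule.smul_mono_left (Ideal.pow_le_pow_right (hle m))
    -- The `I`-adic limit must agree with `f n` modulo `I ^ (e * n)`, so `f n` is first compared
    -- with the later term `f (e * n)`.
    refine ⟨L, fun n => ?_⟩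
    refine (hf (hle n)).trans ?_
    rw [← pow_mul]
    exact hL (e * n)

/-- Krull's intersection theorem in `A / (y)`: the ideal `(y)` is closed in the adic topology. -/
theorem IsLocalRing.dvd_of_forall_mem_sup_pow {A : Type*} [CommRing A] [IsLocalRing A]
    [IsNoetherianRing A] {c y : A}
    (h : ∀ N, ∃ z, c - y * z ∈ maximalIdeal A ^ N) : y ∣ c := by
  have hbot := Ideal.iInf_pow_smul_eq_bot_of_isLocalRing (M := A ⧸ Ideal.span {y})
    (maximalIdeal A) (Ideal.IsPrime.ne_top inferInstance)
  rw [← Ideal.mem_span_singleton, ← Ideal.Quotient.eq_zero_iff_mem, ← Submodule.mem_bot A, ← hbot,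
    Submodule.mem_iInf]
  intro N
  obtain ⟨z, hz⟩ := h N
  have h1 : (Ideal.Quotient.mk (Ideal.span {y}) c) =
      (c - y * z) • (1 : A ⧸ Ideal.span {y}) := by
    rw [Algebra.smul_def, mul_one, Ideal.Quotient.algebraMap_eq, Ideal.Quotient.eq,
      Ideal.mem_span_singleton]
    exact ⟨z, by ring⟩
  rw [h1]
  exact Submodule.smul_mem_smul hz trivial

open IsLocalRing in
/-- Factoriality descends along a local homomorphism that behaves like a completion. -/
theorem UniqueFactorizationMonoid.of_completion {A S : Type*} [CommRing A] [IsDomain A]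
    [IsLocalRing A] [IsNoetherianRing A] [CommRing S] [IsDomain S] [IsLocalRing S]
    [IsNoetherianRing S] [UniqueFactorizationMonoid S] (θ : A →+* S)
    (hcomap : ∀ N x, θ x ∈ maximalIdeal S ^ N ↔ x ∈ maximalIdeal A ^ N)
    (hdense : ∀ N f, ∃ x, f - θ x ∈ maximalIdeal S ^ N) : UniqueFactorizationMonoid A := by
  classical
  let _ : GCDMonoid S := UniqueFactorizationMonoid.toGCDMonoid S
  have hinj : ∀ x, θ x = 0 → x = 0 := by
    intro x hx
    have : x ∈ (⨅ i : ℕ, maximalIdeal A ^ i) := by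
      rw [Submodule.mem_iInf]
      intro N
      rw [← hcomap, hx]
      exact zero_mem _
    rwa [Ideal.iInf_pow_eq_bot_of_isLocalRing _ (Ideal.IsPrime.ne_top inferInstance)] at this
  refine UniqueFactorizationMonoid.of_hasPrincipalColon fun a b ha => ?_
  by_cases hb : b = 0
  · exact ⟨1, fun c => by simp [hb]⟩
  obtain ⟨a', b', hunit, ea, eb⟩ : ∃ a' b' : S, IsRelPrime a' b' ∧ θ a = gcd (θ a) (θ b) * a' ∧
      θ b = gcd (θ a) (θ b) * b' := by
    obtain ⟨a', b', h2, h3, h1⟩ := extract_gcd (θ a) (θ b)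
    exact ⟨a', b', gcd_isUnit_iff_isRelPrime.1 h1, h2, h3⟩
  set g := gcd (θ a) (θ b) with hg
  have hg0 : g ≠ 0 := by
    rintro h0
    exact ha (hinj a (by rw [ea, h0, zero_mul]))
  have hb0 : b' ≠ 0 := by
    rintro h0
    exact hb (hinj b (by rw [eb, h0, mul_zero]))
  have ha0 : a' ≠ 0 := by
    rintro h0
    exact ha (hinj a (by rw [ea, h0, mul_zero]))
  -- solutions of `x a = y b`
  have hsol : ∀ x y, x * a = y * b → ∃ h, θ x = h * b' ∧ θ y = h * a' := by
    intro x y hxy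
    have h1 := congrArg θ hxy
    rw [map_mul, map_mul, ea, eb] at h1
    have h2 : θ x * a' = θ y * b' := mul_left_cancel₀ hg0 (by linear_combination h1)
    obtain ⟨h, hh⟩ : a' ∣ θ y := by
      have : a' ∣ θ y * b' := ⟨θ x, by rw [← h2, mul_comm]⟩
      exact hunit.dvd_of_dvd_mul_right this
    refine ⟨h, mul_right_cancel₀ ha0 ?_, by rw [hh, mul_comm]⟩
    rw [h2, hh]; ring
  -- The exponent `M` detects units: if `h * b'` is congruent to `b'` modulo the `M`-th power, then
  -- `1 - h` is not a unit, so `h` is one.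
  obtain ⟨M, hM⟩ : ∃ M, b' ∉ maximalIdeal S ^ M := by
    by_contra! h
    have : b' ∈ (⨅ i : ℕ, maximalIdeal S ^ i) := by
      rw [Submodule.mem_iInf]
      exact h
    rw [Ideal.iInf_pow_eq_bot_of_isLocalRing _ (Ideal.IsPrime.ne_top inferInstance)] at this
    exact hb0 this
  -- `c` is the Artin–Rees constant of `(a, b)`. The pair `(b', a')` solves `x a = y b` in `S`; an
  -- approximation from `A` to precision `c + M` leaves an error in the `M`-th power of the maximal
  -- ideal times `(a, b)`, so changing `x₀` and `y₀` by elements of that power gives an exact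
  -- solution.
  obtain ⟨c, hc⟩ := Ideal.exists_pow_inf_eq_pow_smul (maximalIdeal A) (M := A)
    (Ideal.span {a, b} : Ideal A)
  obtain ⟨x₀, hx₀⟩ := hdense (c + M) b'
  obtain ⟨y₀, hy₀⟩ := hdense (c + M) a'
  have hmem : x₀ * a - y₀ * b ∈ maximalIdeal A ^ (c + M) := by
    rw [← hcomap]
    have : θ (x₀ * a - y₀ * b) = (a' - θ y₀) * θ b - (b' - θ x₀) * θ a := by
      rw [map_sub, map_mul, map_mul, ea, eb]; ring
    rw [this]
    exact sub_mem (Ideal.mul_mem_right _ _ hy₀) (Ideal.mul_mem_right _ _ hx₀)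
  obtain ⟨u, hu, v, hv, huv⟩ : ∃ u ∈ maximalIdeal A ^ M, ∃ v ∈ maximalIdeal A ^ M,
      x₀ * a - y₀ * b = u * a + v * b := by
    have h1 : x₀ * a - y₀ * b ∈
        (maximalIdeal A ^ (c + M) • ⊤ ⊓ Ideal.span {a, b} : Ideal A) := by
      refine ⟨by simpa using hmem, ?_⟩
      exact sub_mem (Ideal.mul_mem_left _ _ (Ideal.subset_span (by simp)))
        (Ideal.mul_mem_left _ _ (Ideal.subset_span (by simp)))
    rw [hc _ (Nat.le_add_right _ _), Nat.add_sub_cancel_left] at h1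
    have h2 : x₀ * a - y₀ * b ∈ maximalIdeal A ^ M * Ideal.span {a, b} :=
      Submodule.smul_mono le_rfl inf_le_right h1
    rw [Ideal.span_insert, Ideal.mul_sup, Submodule.mem_sup] at h2
    obtain ⟨p, hp, q, hq, hpq⟩ := h2
    obtain ⟨u, hu, rfl⟩ := Ideal.mem_mul_span_singleton.1 hp
    obtain ⟨v, hv, rfl⟩ := Ideal.mem_mul_span_singleton.1 hq
    exact ⟨u, hu, v, hv, hpq.symm⟩
  set x := x₀ - u with hx
  set y := y₀ + v with hy
  have hxy : x * a = y * b := by rw [hx, hy]; linear_combination huv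
  obtain ⟨h, hh1, hh2⟩ := hsol x y hxy
  have hhu : IsUnit h := by
    by_contra hn
    have h1 : IsUnit (1 - h) := by
      by_contra hn'
      have := (maximalIdeal S).add_mem ((mem_maximalIdeal _).2 hn') ((mem_maximalIdeal _).2 hn)
      rw [sub_add_cancel] at this
      exact (Ideal.ne_top_iff_one _).1 (Ideal.IsPrime.ne_top inferInstance) this
    have h2 : (1 - h) * b' ∈ maximalIdeal S ^ M := by
      have : (1 - h) * b' = (b' - θ x₀) + θ u := by
        rw [sub_mul, one_mul, ← hh1, hx, map_sub]; ring
      rw [this]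
      exact add_mem (Ideal.pow_le_pow_right (Nat.le_add_left _ _) hx₀) ((hcomap _ _).2 hu)
    exact hM ((Ideal.unit_mul_mem_iff_mem _ h1).1 h2)
  obtain ⟨h, rfl⟩ := hhu
  -- Up to the unit `h`, `θ y` is `a'`, which generates the colon ideal in `S`. A quotient of `θ c`
  -- by `θ y` in `S` is approximated from `A` to every order, and closedness of `(y)` gives
  -- divisibility in `A`.
  refine ⟨y, fun c => ⟨fun ⟨x₁, hx₁⟩ => ?_, ?_⟩⟩
  · obtain ⟨h₁, -, hc₁⟩ := hsol x₁ c (by rw [hx₁, mul_comm])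
    refine dvd_of_forall_mem_sup_pow fun N => ?_
    obtain ⟨z, hz⟩ := hdense N (h₁ * ↑h⁻¹)
    refine ⟨z, ?_⟩
    rw [← hcomap]
    have : θ (c - y * z) = θ y * (h₁ * ↑h⁻¹ - θ z) := by
      rw [map_sub, map_mul, hc₁, mul_sub, hh2]
      have := h.mul_inv
      linear_combination -(h₁ * a') * this
    rw [this]
    exact Ideal.mul_mem_left _ _ hz
  · rintro ⟨z, rfl⟩
    exact ⟨x * z, by linear_combination -z * hxy⟩

/-! ### Formal coordinates at a rational point of a formally smooth local algebra. -/

namespace FormalCoordinates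

open IsLocalRing MvPowerSeries

variable {k A : Type*} [Field k] [CommRing A] [IsLocalRing A] [Algebra k A] {n : ℕ}

theorem homogeneous_truncTotal (f : MvPowerSeries (Fin n) k) (d : ℕ) (hd : (d : ℕ∞) ≤ f.order) :
    (truncTotal (d + 1) f).IsHomogeneous d := by
  intro e he
  rw [Finsupp.weight_apply, Finsupp.sum_fintype _ _ (by simp)]
  have hdeg : ∑ i, e i • (1 : Fin n → ℕ) i = Finsupp.degree e := by
    simp [Finsupp.degree_eq_sum]
  rw [hdeg]
  by_contra hne
  apply he
  rcases lt_or_gt_of_ne hne with h | h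
  · rw [coeff_truncTotal _ (by omega)]
    exact coeff_of_lt_order (lt_of_lt_of_le (by exact_mod_cast h) hd)
  · exact coeff_truncTotal_eq_zero _ (by omega)

theorem sub_truncTotal_mem (f : MvPowerSeries (Fin n) k) (d : ℕ) :
    f - (truncTotal d f : MvPowerSeries (Fin n) k) ∈ varIdeal k n ^ d := by
  refine mem_varIdeal_pow_of_le_order _ _ (nat_le_order fun e he => ?_)
  rw [map_sub, MvPolynomial.coeff_coe, coeff_truncTotal _ he, sub_self]

theorem eq_zero_of_coe_mem (p : MvPolynomial (Fin n) k) (d : ℕ) (hp : p.IsHomogeneous d)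
    (h : (p : MvPowerSeries (Fin n) k) ∈ varIdeal k n ^ (d + 1)) : p = 0 := by
  ext e
  rw [MvPolynomial.coeff_zero]
  by_contra he
  have h1 := hp he
  rw [Finsupp.weight_apply, Finsupp.sum_fintype _ _ (by simp)] at h1
  have hdeg : ∑ i, e i • (1 : Fin n → ℕ) i = Finsupp.degree e := by
    simp [Finsupp.degree_eq_sum]
  rw [hdeg] at h1
  apply he
  rw [← MvPolynomial.coeff_coe]
  refine coeff_of_lt_order (lt_of_lt_of_le ?_ (le_order_of_mem_varIdeal_pow _ _ h))
  rw [h1]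
  exact_mod_cast Nat.lt_succ_self d

variable (θ : A →ₐ[k] MvPowerSeries (Fin n) k) (y : Fin n → A)

theorem prod_pow_single {R : Type*} [CommRing R] (z : Fin n → R) (i : Fin n) (m : ℕ) :
    ∏ j, z j ^ (Finsupp.single i m) j = z i ^ m := by
  rw [Finset.prod_eq_single i]
  · simp
  · intro j _ hj; simp [hj.symm]
  · simp

/-- The second membership is carried along because it lets the error estimate pass to products. -/
theorem map_monomial_sub_mem (hy : ∀ i, θ (y i) - X i ∈ varIdeal k n ^ 2) (e : Fin n →₀ ℕ) :
    θ (∏ i, y i ^ e i) - ∏ i, X i ^ e i ∈ varIdeal k n ^ (Finsupp.degree e + 1) ∧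
      ∏ i, X i ^ e i ∈ varIdeal k n ^ Finsupp.degree e := by
  have hmul : ∀ (i j : ℕ) (a a' b b' : MvPowerSeries (Fin n) k), a - a' ∈ varIdeal k n ^ (i + 1) ∧
      a' ∈ varIdeal k n ^ i → b - b' ∈ varIdeal k n ^ (j + 1) ∧ b' ∈ varIdeal k n ^ j →
      a * b - a' * b' ∈ varIdeal k n ^ (i + j + 1) ∧ a' * b' ∈ varIdeal k n ^ (i + j) := by
    rintro i j a a' b b' ⟨h1, h2⟩ ⟨h3, h4⟩
    refine ⟨?_, by rw [pow_add]; exact Ideal.mul_mem_mul h2 h4⟩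
    have : a * b - a' * b' = (a - a') * (b - b') + (a - a') * b' + a' * (b - b') := by ring
    rw [this]
    refine add_mem (add_mem ?_ ?_) ?_
    · refine Ideal.pow_le_pow_right (show i + j + 1 ≤ (i + 1) + (j + 1) by omega) ?_
      rw [pow_add]; exact Ideal.mul_mem_mul h1 h3
    · rw [show i + j + 1 = (i + 1) + j by omega, pow_add]; exact Ideal.mul_mem_mul h1 h4
    · rw [add_assoc, pow_add]; exact Ideal.mul_mem_mul h2 h3
  induction e using Finsupp.induction_linear with
  | zero => simp
  | add e f he hf =>
    have := hmul _ _ _ _ _ _ he hf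
    simp only [Finsupp.add_apply, pow_add, Finset.prod_mul_distrib, map_mul, map_add]
    simpa only [pow_add] using this
  | single i m =>
    rw [prod_pow_single, prod_pow_single, Finsupp.degree_single]
    induction m with
    | zero => simp
    | succ m ih =>
      rw [pow_succ (y i), pow_succ (X i), map_mul]
      exact hmul m 1 _ _ _ _ ih ⟨hy i, by rw [pow_one]; exact Ideal.subset_span ⟨i, rfl⟩⟩

/-- Since `θ (y i)` and `X i` agree to first order, `θ` sends a form in the `y i` to a series with
the same form as its leading term. -/
theorem map_aeval_sub_mem (hy : ∀ i, θ (y i) - X i ∈ varIdeal k n ^ 2)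
    (p : MvPolynomial (Fin n) k) (d : ℕ) (hp : p.IsHomogeneous d) :
    θ (MvPolynomial.aeval y p) - p ∈ varIdeal k n ^ (d + 1) := by
  have hX : (p : MvPowerSeries (Fin n) k) = MvPolynomial.aeval (X : Fin n → _) p := by
    rw [← subst_coe, subst_self]; rfl
  rw [hX, MvPolynomial.aeval_def, MvPolynomial.aeval_def, MvPolynomial.eval₂_eq',
    MvPolynomial.eval₂_eq', map_sum, ← Finset.sum_sub_distrib]
  refine Ideal.sum_mem _ fun e he => ?_
  have h1 := hp (MvPolynomial.mem_support_iff.1 he)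
  rw [Finsupp.weight_apply, Finsupp.sum_fintype _ _ (by simp)] at h1
  have hdeg : ∑ i, e i • (1 : Fin n → ℕ) i = Finsupp.degree e := by
    simp [Finsupp.degree_eq_sum]
  rw [hdeg] at h1
  rw [map_mul, AlgHom.commutes, ← mul_sub, ← h1]
  exact Ideal.mul_mem_left _ _ (map_monomial_sub_mem θ y hy e).1

/-- As the residue field is `k` and the `y i` span the cotangent space, forms of degree `d` in the
`y i` represent every class of the `d`-th power of the maximal ideal modulo the next power. -/
theorem exists_homogeneous_sub_mem (hres : Function.Surjective (algebraMap k (ResidueField A)))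
    (hspan : ∀ b ∈ maximalIdeal A, ∃ c : Fin n → k, b - ∑ i, c i • y i ∈ maximalIdeal A ^ 2)
    (d : ℕ) (r : A) (hr : r ∈ maximalIdeal A ^ d) :
    ∃ p : MvPolynomial (Fin n) k, p.IsHomogeneous d ∧
      r - MvPolynomial.aeval y p ∈ maximalIdeal A ^ (d + 1) := by
  induction d generalizing r with
  | zero =>
    obtain ⟨c, hc⟩ := hres (residue A r)
    refine ⟨MvPolynomial.C c, MvPolynomial.isHomogeneous_C _ _, ?_⟩
    rw [zero_add, pow_one, ← residue_eq_zero_iff, map_sub, ← hc, MvPolynomial.aeval_C,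
      ← ResidueField.algebraMap_eq, ← IsScalarTower.algebraMap_apply, sub_self]
  | succ d ih =>
    rw [pow_succ] at hr
    induction hr using Submodule.mul_induction_on' with
    | mem_mul_mem a ha b hb =>
      obtain ⟨p, hp, hap⟩ := ih a ha
      obtain ⟨c, hc⟩ := hspan b hb
      have hpm : MvPolynomial.aeval y p ∈ maximalIdeal A ^ d := by
        have : MvPolynomial.aeval y p = a - (a - MvPolynomial.aeval y p) := by ring
        rw [this]
        exact sub_mem ha (Ideal.pow_le_pow_right (Nat.le_succ d) hap)
      refine ⟨p * ∑ i, c i • MvPolynomial.X i, hp.mul ?_, ?_⟩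
      · refine MvPolynomial.IsHomogeneous.sum _ _ _ fun i _ => ?_
        exact Submodule.smul_mem (MvPolynomial.homogeneousSubmodule (Fin n) k 1) _ (MvPolynomial.isHomogeneous_X _ _)
      · have : MvPolynomial.aeval y (p * ∑ i, c i • MvPolynomial.X i) =
            MvPolynomial.aeval y p * ∑ i, c i • y i := by
          simp
        rw [this]
        have : a * b - MvPolynomial.aeval y p * ∑ i, c i • y i =
            (a - MvPolynomial.aeval y p) * b +
              MvPolynomial.aeval y p * (b - ∑ i, c i • y i) := by ring
        rw [this]
        refine add_mem ?_ ?_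
        · rw [pow_succ _ (d + 1)]; exact Ideal.mul_mem_mul hap hb
        · rw [add_assoc, pow_add _ d]; exact Ideal.mul_mem_mul hpm hc
    | add a _ b _ ha hb =>
      obtain ⟨p, hp, hap⟩ := ha
      obtain ⟨q, hq, hbq⟩ := hb
      refine ⟨p + q, hp.add hq, ?_⟩
      have : a + b - MvPolynomial.aeval y (p + q) =
        (a - MvPolynomial.aeval y p) + (b - MvPolynomial.aeval y q) := by
        rw [map_add]; ring
      rw [this]
      exact add_mem hap hbq

variable {θ y}

/-- The converse is injectivity on associated graded rings: modulo the next power, an element of the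
`N`-th power is a form of degree `N` in the `y i`. `θ` preserves that form, so it is zero if the
image has order above `N`. -/
theorem map_mem_pow_iff (hres : Function.Surjective (algebraMap k (ResidueField A)))
    (hspan : ∀ b ∈ maximalIdeal A, ∃ c : Fin n → k, b - ∑ i, c i • y i ∈ maximalIdeal A ^ 2)
    (hy : ∀ i, θ (y i) - X i ∈ varIdeal k n ^ 2)
    (hθ : ∀ r ∈ maximalIdeal A, θ r ∈ varIdeal k n) (N : ℕ) (r : A) :
    θ r ∈ varIdeal k n ^ N ↔ r ∈ maximalIdeal A ^ N := by
  have hle : ∀ N, ∀ r ∈ maximalIdeal A ^ N, θ r ∈ varIdeal k n ^ N := by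
    intro N r hr
    have h1 : (maximalIdeal A).map θ ≤ varIdeal k n := Ideal.map_le_iff_le_comap.2 hθ
    have h2 := Ideal.mem_map_of_mem θ hr
    rw [Ideal.map_pow] at h2
    exact Ideal.pow_right_mono h1 N h2
  refine ⟨fun h => ?_, hle N r⟩
  induction N with
  | zero => simp
  | succ N ih =>
    have hr := ih (Ideal.pow_le_pow_right (Nat.le_succ N) h)
    obtain ⟨p, hp, hrp⟩ := exists_homogeneous_sub_mem y hres hspan N r hr
    have h1 : (p : MvPowerSeries (Fin n) k) ∈ varIdeal k n ^ (N + 1) := by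
      have : (p : MvPowerSeries (Fin n) k) = θ r - θ (r - MvPolynomial.aeval y p) -
        (θ (MvPolynomial.aeval y p) - p) := by rw [map_sub]; ring
      rw [this]
      exact sub_mem (sub_mem h (hle _ _ hrp)) (map_aeval_sub_mem θ y hy p N hp)
    rw [eq_zero_of_coe_mem p N hp h1] at hrp
    simpa using hrp

/-- The approximation is improved degree by degree, by adding the leading form of the error
evaluated at `y`. -/
theorem exists_sub_map_mem (hy : ∀ i, θ (y i) - X i ∈ varIdeal k n ^ 2) (N : ℕ)
    (f : MvPowerSeries (Fin n) k) : ∃ r, f - θ r ∈ varIdeal k n ^ N := by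
  induction N with
  | zero => exact ⟨0, by simp⟩
  | succ N ih =>
    obtain ⟨r, hr⟩ := ih
    have hp := homogeneous_truncTotal _ N (le_order_of_mem_varIdeal_pow _ _ hr)
    refine ⟨r + MvPolynomial.aeval y (truncTotal (N + 1) (f - θ r)), ?_⟩
    have := sub_mem (sub_truncTotal_mem (f - θ r) (N + 1)) (map_aeval_sub_mem θ y hy _ N hp)
    convert this using 1
    rw [map_add]; ring

theorem exists_residue (hres : Function.Surjective (algebraMap k (ResidueField A))) :
    ∃ ε : A →ₐ[k] k, ∀ r, r - algebraMap k A (ε r) ∈ maximalIdeal A := by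
  let e : k ≃ₐ[k] ResidueField A := AlgEquiv.ofBijective (Algebra.ofId k (ResidueField A))
    ⟨(algebraMap k (ResidueField A)).injective, hres⟩
  refine ⟨e.symm.toAlgHom.comp (IsScalarTower.toAlgHom k A (ResidueField A)), fun r => ?_⟩
  rw [← residue_eq_zero_iff, map_sub, sub_eq_zero]
  have h1 : residue A (algebraMap k A (e.symm (residue A r))) = e (e.symm (residue A r)) := rfl
  have h2 : residue A r = e (e.symm (residue A r)) := (e.apply_symm_apply _).symm
  exact h2.trans h1.symm

theorem residue_eq_zero (ε : A →ₐ[k] k) (hε : ∀ r, r - algebraMap k A (ε r) ∈ maximalIdeal A)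
    (r : A) (hr : r ∈ maximalIdeal A) : ε r = 0 := by
  by_contra h
  have h1 : algebraMap k A (ε r) ∈ maximalIdeal A := by
    have : algebraMap k A (ε r) = r - (r - algebraMap k A (ε r)) := by ring
    rw [this]
    exact sub_mem hr (hε r)
  exact (mem_maximalIdeal _).1 h1 ((isUnit_iff_ne_zero.2 h).map _)

/-- The differential of a function at a rational point. -/
noncomputable def differential (ε : A →ₐ[k] k)
    (hε : ∀ r, r - algebraMap k A (ε r) ∈ maximalIdeal A) : A →ₗ[k] CotangentSpace A where
  toFun r := (maximalIdeal A).toCotangent ⟨r - algebraMap k A (ε r), hε r⟩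
  map_add' r s := by
    rw [← map_add]
    congr 1
    ext
    simp only [map_add, Submodule.coe_add]
    ring
  map_smul' c r := by
    rw [RingHom.id_apply, ← algebraMap_smul A c ((maximalIdeal A).toCotangent _), ← map_smul]
    congr 1
    ext
    simp only [Submodule.coe_smul, smul_eq_mul, map_mul, Algebra.smul_def, mul_sub,
      AlgHom.commutes, Algebra.algebraMap_self, RingHom.id_apply]

theorem differential_mul (ε : A →ₐ[k] k)
    (hε : ∀ r, r - algebraMap k A (ε r) ∈ maximalIdeal A) (r s : A) :
    differential ε hε (r * s) = ε r • differential ε hε s + ε s • differential ε hε r := by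
  rw [← algebraMap_smul A (ε r), ← algebraMap_smul A (ε s)]
  simp only [differential, LinearMap.coe_mk, AddHom.coe_mk]
  rw [← map_smul, ← map_smul, ← map_add, Ideal.toCotangent_eq]
  simp only [Submodule.coe_add, Submodule.coe_smul, smul_eq_mul, map_mul]
  have : r * s - algebraMap k A (ε r) * algebraMap k A (ε s) -
      (algebraMap k A (ε r) * (s - algebraMap k A (ε s)) +
        algebraMap k A (ε s) * (r - algebraMap k A (ε r))) =
      (r - algebraMap k A (ε r)) * (s - algebraMap k A (ε s)) := by ring
  rw [this, pow_two]
  exact Ideal.mul_mem_mul (hε r) (hε s)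

variable (A) in
-- With coordinates from a basis of the cotangent space, the Taylor expansion `r ↦ ε r + dr` is, by
-- the Leibniz rule, an algebra map to power series modulo the square of `varIdeal k n`. Formal
-- smoothness lifts it, since the power series ring is complete for that square.
theorem exists_formal_coordinates [IsNoetherianRing A] [Algebra.FormallySmooth k A]
    (hres : Function.Surjective (algebraMap k (ResidueField A))) :
    ∃ (n : ℕ) (θ : A →ₐ[k] MvPowerSeries (Fin n) k) (y : Fin n → A),
      (∀ b ∈ maximalIdeal A, ∃ c : Fin n → k, b - ∑ i, c i • y i ∈ maximalIdeal A ^ 2) ∧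
      (∀ i, θ (y i) - X i ∈ varIdeal k n ^ 2) ∧
      ∀ r ∈ maximalIdeal A, θ r ∈ varIdeal k n := by
  obtain ⟨ε, hε⟩ := exists_residue hres
  have hfin : Module.Finite k (CotangentSpace A) := by
    have : Module.Finite k (ResidueField A) :=
      Module.Finite.of_surjective (Algebra.linearMap k (ResidueField A)) hres
    have : IsScalarTower k (ResidueField A) (CotangentSpace A) := by
      refine ⟨fun c r v => ?_⟩
      obtain ⟨r, rfl⟩ := residue_surjective r
      have h1 : c • residue A r = algebraMap A (ResidueField A) (algebraMap k A c * r) := by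
        rw [map_mul, ← IsScalarTower.algebraMap_apply, ← Algebra.smul_def]
        rfl
      have h2 : residue A r • v = r • v := algebraMap_smul (ResidueField A) r v
      rw [h1, h2, algebraMap_smul, ← algebraMap_smul A c, mul_smul]
    exact Module.Finite.trans (ResidueField A) (CotangentSpace A)
  let n := Module.finrank k (CotangentSpace A)
  let bas : Module.Basis (Fin n) k (CotangentSpace A) := Module.finBasis k (CotangentSpace A)
  choose y hy using fun i => (maximalIdeal A).toCotangent_surjective (bas i)
  let lin : A →ₗ[k] MvPowerSeries (Fin n) k :=
    (Algebra.linearMap k _).comp ε.toLinearMap +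
      (Fintype.linearCombination k (X : Fin n → MvPowerSeries (Fin n) k)).comp
        ((bas.equivFun : _ →ₗ[k] (Fin n → k)).comp (differential ε hε))
  have hlin : ∀ r, lin r = C (ε r) + ∑ i, bas.equivFun (differential ε hε r) i • X i := fun r => rfl
  have hsm : ∀ r, lin r - C (ε r) ∈ varIdeal k n := by
    intro r
    rw [hlin, add_sub_cancel_left]
    refine Ideal.sum_mem _ fun i _ => ?_
    rw [smul_eq_C_mul]
    exact Ideal.mul_mem_left _ _ (Ideal.subset_span ⟨i, rfl⟩)
  let f : A →ₐ[k] MvPowerSeries (Fin n) k ⧸ varIdeal k n ^ 2 :=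
    AlgHom.ofLinearMap ((Ideal.Quotient.mkₐ k (varIdeal k n ^ 2)).toLinearMap.comp lin)
      (by
        have h1 : differential ε hε 1 = 0 := by
          have := differential_mul ε hε 1 1
          simpa using this
        change Ideal.Quotient.mk _ (lin 1) = 1
        rw [hlin, h1]
        simp)
      (by
        intro r s
        change Ideal.Quotient.mk _ (lin (r * s)) =
          Ideal.Quotient.mk _ (lin r) * Ideal.Quotient.mk _ (lin s)
        rw [← map_mul, Ideal.Quotient.eq]
        have h1 : lin (r * s) = C (ε r) * (lin s - C (ε s)) + C (ε s) * (lin r - C (ε r)) +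
            C (ε r) * C (ε s) := by
          rw [hlin, hlin, hlin, differential_mul]
          simp only [map_add, map_smul, Pi.add_apply, Pi.smul_apply, add_smul,
            Finset.sum_add_distrib, add_sub_cancel_left, Finset.mul_sum, smul_eq_C_mul, map_mul,
            smul_eq_mul, mul_assoc]
          ring
        have h2 : lin (r * s) - lin r * lin s = -((lin r - C (ε r)) * (lin s - C (ε s))) := by
          rw [h1]; ring
        rw [h2, pow_two]
        exact neg_mem (Ideal.mul_mem_mul (hsm r) (hsm s)))
  have := IsAdicComplete.pow (I := varIdeal k n) 2 two_pos
  obtain ⟨θ, hθ⟩ := Algebra.FormallySmooth.exists_mkₐ_comp_eq_of_isAdicComplete f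
  have hθ' : ∀ r, θ r - lin r ∈ varIdeal k n ^ 2 := by
    intro r
    rw [← Ideal.Quotient.eq]
    exact DFunLike.congr_fun hθ r
  have hdiff : ∀ r (hr : r ∈ maximalIdeal A),
      differential ε hε r = (maximalIdeal A).toCotangent ⟨r, hr⟩ := by
    intro r hr
    simp [differential, residue_eq_zero ε hε r hr]
  refine ⟨n, θ, fun i => y i, fun b hb => ?_, fun i => ?_, fun r hr => ?_⟩
  · refine ⟨fun i => bas.repr ((maximalIdeal A).toCotangent ⟨b, hb⟩) i, ?_⟩
    have h1 : (maximalIdeal A).toCotangent ⟨b, hb⟩ = (maximalIdeal A).toCotangent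
        (∑ i, algebraMap k A (bas.repr ((maximalIdeal A).toCotangent ⟨b, hb⟩) i) • y i) := by
      rw [map_sum]
      refine (bas.sum_repr _).symm.trans (Finset.sum_congr rfl fun i _ => ?_)
      rw [map_smul, hy, algebraMap_smul]
    rw [Ideal.toCotangent_eq] at h1
    simpa [Algebra.smul_def] using h1
  · have h1 : lin (y i) = X i := by
      rw [hlin, residue_eq_zero ε hε _ (y i).2, hdiff _ (y i).2, hy]
      simp
    have := hθ' (y i)
    rwa [h1] at this
  · have h1 := hsm r
    rw [residue_eq_zero ε hε r hr, map_zero, sub_zero] at h1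
    have h2 := Ideal.pow_le_self two_ne_zero (hθ' r)
    simpa using add_mem h2 h1

end FormalCoordinates

open IsLocalRing in
/-- The local ring of a smooth variety at a rational point is factorial. -/
theorem UniqueFactorizationMonoid.of_formallySmooth (k : Type*) {A : Type*} [Field k] [Infinite k]
    [CommRing A] [IsDomain A] [IsLocalRing A] [IsNoetherianRing A] [Algebra k A]
    [Algebra.FormallySmooth k A] (hres : Function.Surjective (algebraMap k (ResidueField A))) :
    UniqueFactorizationMonoid A := by
  obtain ⟨n, θ, y, hspan, hy, hθ⟩ := FormalCoordinates.exists_formal_coordinates A hres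
  have hdom : IsDomain (MvPowerSeries (Fin n) k) := NoZeroDivisors.to_isDomain _
  refine UniqueFactorizationMonoid.of_completion θ.toRingHom (fun N x => ?_) fun N f => ?_
  · rw [MvPowerSeries.maximalIdeal_eq_varIdeal]
    exact FormalCoordinates.map_mem_pow_iff hres hspan hy hθ N x
  · rw [MvPowerSeries.maximalIdeal_eq_varIdeal]
    exact FormalCoordinates.exists_sub_map_mem hy N f

/-! ### Primitive vectors: existence, spreading, and units in dimension one. -/

/-- A vector `v` over a field `K` is primitive with respect to a subring `O` if the fractional
ideal `(O : v)` is `O` itself. -/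
def IsPrimitive {K ι : Type*} [Field K] (O : Set K) (v : ι → K) : Prop :=
  ∀ c, (∀ i, c * v i ∈ O) ↔ c ∈ O

/-- Here `d = g / b` with a common denominator `b` and the gcd `g` of the numerators. If `p / q`
multiplies the coprime entries `w i` into `A`, then `q` divides the gcd of the `p * w i`, which is
`p` up to a unit. -/
theorem UniqueFactorizationMonoid.exists_isPrimitive {A K ι : Type*} [CommRing A] [IsDomain A]
    [UniqueFactorizationMonoid A] [Field K] [Algebra A K] [IsFractionRing A K] [Finite ι]
    (v : ι → K) (hv : ∃ i, v i ≠ 0) :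
    ∃ d : K, d ≠ 0 ∧ IsPrimitive (Set.range (algebraMap A K)) fun i => v i / d := by
  classical
  cases nonempty_fintype ι
  let _ : StrongNormalizationMonoid A := UniqueFactorizationMonoid.strongNormalizationMonoid
  let _ : StrongNormalizedGCDMonoid A := UniqueFactorizationMonoid.toStrongNormalizedGCDMonoid A
  obtain ⟨b, hb⟩ := IsLocalization.exist_integer_multiples_of_finite (nonZeroDivisors A) v
  choose n hn using hb
  have hb0 : algebraMap A K b ≠ 0 := IsFractionRing.to_map_ne_zero_of_mem_nonZeroDivisors b.2
  have hn' : ∀ i, algebraMap A K (n i) = algebraMap A K b * v i := fun i => by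
    rw [hn i, Algebra.smul_def]
  obtain ⟨i₀, hi₀⟩ := hv
  have hni₀ : n i₀ ≠ 0 := by
    intro h
    have := hn' i₀
    rw [h, map_zero] at this
    exact mul_ne_zero hb0 hi₀ this.symm
  obtain ⟨w, hw, hw1⟩ := Finset.extract_gcd n (s := Finset.univ) ⟨i₀, Finset.mem_univ _⟩
  set g := Finset.univ.gcd n with hg
  have hg0 : algebraMap A K g ≠ 0 := by
    rw [Ne, FaithfulSMul.algebraMap_eq_zero_iff]
    intro h
    apply hni₀
    rw [hw i₀ (Finset.mem_univ _), h, zero_mul]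
  have hvd : ∀ i, v i / (algebraMap A K g / algebraMap A K b) = algebraMap A K (w i) := by
    intro i
    have h1 := hn' i
    rw [hw i (Finset.mem_univ _), map_mul] at h1
    field_simp
    linear_combination -h1
  refine ⟨algebraMap A K g / algebraMap A K b, div_ne_zero hg0 hb0, fun c => ?_⟩
  simp only [hvd]
  constructor
  · intro h
    choose r hr using h
    obtain ⟨p, q, hq, rfl⟩ := IsFractionRing.div_surjective (A := A) c
    have hq0 : algebraMap A K q ≠ 0 := IsFractionRing.to_map_ne_zero_of_mem_nonZeroDivisors hq
    have h1 : q ∣ Finset.univ.gcd fun i => p * w i := by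
      refine Finset.dvd_gcd fun i _ => ⟨r i, ?_⟩
      apply IsFractionRing.injective A K
      rw [map_mul, map_mul, hr]
      field_simp
    rw [Finset.gcd_mul_left, hw1, mul_one, dvd_normalize_iff] at h1
    obtain ⟨t, rfl⟩ := h1
    refine ⟨t, ?_⟩
    rw [map_mul]
    field_simp
  · rintro ⟨t, rfl⟩ i
    exact ⟨t * w i, map_mul _ _ _⟩

/-- The local ring at `q`, as a subset of the fraction field. -/
def localizationSet {R : Type*} (K : Type*) [CommRing R] [Field K] [Algebra R K] (q : Ideal R) :
    Set K :=
  {x | ∃ s ∉ q, ∃ r, algebraMap R K s * x = algebraMap R K r}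

theorem range_eq_localizationSet {R A K : Type*} [CommRing R] [CommRing A] [Field K] [Algebra R A]
    [Algebra A K] [Algebra R K] [IsScalarTower R A K] (q : Ideal R) [q.IsPrime]
    [IsLocalization.AtPrime A q] :
    Set.range (algebraMap A K) = localizationSet K q := by
  ext x
  constructor
  · rintro ⟨y, rfl⟩
    obtain ⟨⟨r, s⟩, h⟩ := IsLocalization.surj q.primeCompl y
    refine ⟨s, s.2, r, ?_⟩
    rw [IsScalarTower.algebraMap_apply R A K, IsScalarTower.algebraMap_apply R A K, ← h, map_mul,
      mul_comm]
  · rintro ⟨s, hs, r, h⟩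
    obtain ⟨u, hu⟩ := IsLocalization.map_units A (⟨s, hs⟩ : q.primeCompl)
    refine ⟨algebraMap R A r * ↑u⁻¹, ?_⟩
    rw [map_mul, ← IsScalarTower.algebraMap_apply, ← h, IsScalarTower.algebraMap_apply R A K]
    change algebraMap A K (algebraMap R A (⟨s, hs⟩ : q.primeCompl)) * x * _ = x
    rw [← hu, mul_right_comm, ← map_mul, Units.mul_inv, map_one, one_mul]

/-- The colon module `N = (R : w)` lies in `R • (w i)⁻¹` for a nonzero entry, so it is finitely
generated, and primitivity at `m` puts its generators in the local ring. A common denominator `f` of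
these generators and of the entries of `w` then gives primitivity wherever `f` is invertible. -/
theorem IsPrimitive.exists_spread {R K ι : Type*} [CommRing R] [IsDomain R] [IsNoetherianRing R]
    [Field K] [Algebra R K] [IsFractionRing R K] [Finite ι] (m : Ideal R) [hm : m.IsPrime]
    (w : ι → K) (hw : ∃ i, w i ≠ 0) (h : IsPrimitive (localizationSet K m) w) :
    ∃ f ∉ m, ∀ q : Ideal R, q.IsPrime → f ∉ q → IsPrimitive (localizationSet K q) w := by
  classical
  cases nonempty_fintype ι
  let N : Submodule R K :=
    { carrier := {c | ∀ i, ∃ r, c * w i = algebraMap R K r}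
      zero_mem' := fun i => ⟨0, by simp⟩
      add_mem' := fun {a b} ha hb i => by
        obtain ⟨r, hr⟩ := ha i
        obtain ⟨s, hs⟩ := hb i
        exact ⟨r + s, by rw [add_mul, hr, hs, map_add]⟩
      smul_mem' := fun a b hb i => by
        obtain ⟨s, hs⟩ := hb i
        exact ⟨a * s, by rw [Algebra.smul_def, mul_assoc, hs, map_mul]⟩ }
  have hN : N.FG := by
    obtain ⟨i, hi⟩ := hw
    have hle : N ≤ Submodule.span R {(w i)⁻¹} := by
      intro c hc
      obtain ⟨r, hr⟩ := hc i
      rw [Submodule.mem_span_singleton]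
      exact ⟨r, by rw [Algebra.smul_def, ← hr, mul_assoc, mul_inv_cancel₀ hi, mul_one]⟩
    have : IsNoetherian R (Submodule.span R {(w i)⁻¹}) :=
      isNoetherian_span_of_finite R (Set.finite_singleton _)
    have h2 := (isNoetherian_submodule.1 this) N hle
    exact h2
  have hone : ∀ q : Ideal R, q.IsPrime → ∀ r, algebraMap R K r ∈ localizationSet K q :=
    fun q hq r => ⟨1, fun h1 => hq.ne_top ((Ideal.eq_top_iff_one _).2 h1), r, by simp⟩
  obtain ⟨S, hS⟩ := hN
  have hfin : ∀ T : Finset K, (∀ x ∈ T, x ∈ localizationSet K m) →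
      ∃ f ∉ m, ∀ x ∈ T, ∃ r, algebraMap R K f * x = algebraMap R K r := by
    intro T hT
    induction T using Finset.induction_on with
    | empty => exact ⟨1, fun h1 => hm.ne_top ((Ideal.eq_top_iff_one _).2 h1), by simp⟩
    | insert x T hx ih =>
      obtain ⟨f, hf, hfT⟩ := ih fun y hy => hT y (Finset.mem_insert_of_mem hy)
      obtain ⟨s, hs, r, hr⟩ := hT x (Finset.mem_insert_self _ _)
      refine ⟨s * f, fun h => (hm.mem_or_mem h).elim hs hf, fun y hy => ?_⟩
      rcases Finset.mem_insert.1 hy with rfl | hy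
      · exact ⟨f * r, by rw [map_mul, map_mul, ← hr]; ring⟩
      · obtain ⟨r', hr'⟩ := hfT y hy
        exact ⟨s * r', by rw [map_mul, map_mul, ← hr']; ring⟩
  obtain ⟨f, hf, hfT⟩ := hfin (S ∪ Finset.univ.image w) (by
    intro x hx
    rcases Finset.mem_union.1 hx with hx | hx
    · have hxN : x ∈ N := hS ▸ Submodule.subset_span hx
      refine (h x).1 fun i => ?_
      obtain ⟨r, hr⟩ := hxN i
      rw [hr]
      exact hone m hm r
    · obtain ⟨i, -, rfl⟩ := Finset.mem_image.1 hx
      have := (h 1).2 (by rw [← map_one (algebraMap R K)]; exact hone m hm 1) i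
      rwa [one_mul] at this)
  refine ⟨f, hf, fun q hq hfq c => ⟨fun hc => ?_, fun hc i => ?_⟩⟩
  · choose s hs r hr using hc
    have hprod : ∏ i, s i ∉ q := fun hp => by
      obtain ⟨i, -, hi⟩ := (Ideal.IsPrime.prod_mem_iff (hp := hq)).1 hp
      exact hs i hi
    have hcN : algebraMap R K (∏ i, s i) * c ∈ N := by
      intro i
      refine ⟨(∏ j ∈ Finset.univ.erase i, s j) * r i, ?_⟩
      rw [← Finset.mul_prod_erase _ _ (Finset.mem_univ i), map_mul, map_mul, ← hr i]
      ring
    have hNf : ∀ x ∈ N, ∃ r, algebraMap R K f * x = algebraMap R K r := by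
      intro x hx
      rw [← hS] at hx
      induction hx using Submodule.span_induction with
      | mem x hx => exact hfT x (Finset.mem_union_left _ hx)
      | zero => exact ⟨0, by simp⟩
      | add x y _ _ hx hy =>
        obtain ⟨r, hr⟩ := hx
        obtain ⟨s, hs⟩ := hy
        exact ⟨r + s, by rw [mul_add, hr, hs, map_add]⟩
      | smul a x _ hx =>
        obtain ⟨r, hr⟩ := hx
        exact ⟨a * r, by rw [Algebra.smul_def, map_mul, ← hr]; ring⟩
    obtain ⟨r', hr'⟩ := hNf _ hcN
    refine ⟨f * ∏ i, s i, fun hmem => (hq.mem_or_mem hmem).elim hfq hprod, r', ?_⟩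
    rw [map_mul, mul_assoc, hr']
  · obtain ⟨s, hs, r, hr⟩ := hc
    obtain ⟨r', hr'⟩ := hfT (w i) (Finset.mem_union_right _ (Finset.mem_image_of_mem _ (Finset.mem_univ i)))
    refine ⟨f * s, fun hmem => (hq.mem_or_mem hmem).elim hfq hs, r' * r, ?_⟩
    rw [map_mul, map_mul, ← hr, ← hr']
    ring

/-- Together with `IsPrimitive.inv_mem_of_mul`: the factor between two proportional primitive
vectors is a unit of `O`. All transition functions below are controlled this way. -/
theorem IsPrimitive.mem_of_mul {K ι : Type*} [Field K] {O : Subring K} {v : ι → K} {l : K}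
    (hv : IsPrimitive O v) (hlv : IsPrimitive O fun i => l * v i) : l ∈ O := by
  refine (hv l).1 fun i => ?_
  have := (hlv 1).2 O.one_mem i
  rwa [one_mul] at this

theorem IsPrimitive.mem {K ι : Type*} [Field K] {O : Subring K} {v : ι → K}
    (hv : IsPrimitive O v) (i : ι) : v i ∈ O := by
  simpa using (hv 1).2 O.one_mem i

theorem IsPrimitive.inv_mem_of_mul {K ι : Type*} [Field K] {O : Subring K} {v : ι → K} {l : K}
    (hl : l ≠ 0) (hv : IsPrimitive O v) (hlv : IsPrimitive O fun i => l * v i) : l⁻¹ ∈ O := by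
  refine hlv.mem_of_mul ?_
  simpa [hl] using hv

open IsLocalRing in
/-- In a one-dimensional noetherian local domain, some entry of a primitive vector is a unit. -/
theorem IsPrimitive.exists_isUnit {A K ι : Type*} [CommRing A] [IsDomain A] [IsLocalRing A]
    [IsNoetherianRing A] [Ring.KrullDimLE 1 A] [Field K] [Algebra A K] [IsFractionRing A K]
    (hA : ¬ IsField A) {v : ι → A}
    (hv : IsPrimitive (Set.range (algebraMap A K)) fun i => algebraMap A K (v i)) :
    ∃ i, IsUnit (v i) := by
  by_contra! hall
  obtain ⟨t, htm, ht0⟩ : ∃ t ∈ maximalIdeal A, t ≠ 0 := by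
    by_contra! h
    exact hA (isField_iff_maximalIdeal_eq.2 ((Submodule.eq_bot_iff _).2 h))
  have hnt : Nontrivial (A ⧸ Ideal.span {t}) := by
    rw [Ideal.Quotient.nontrivial_iff]
    intro h
    exact (mem_maximalIdeal _).1 htm (Ideal.span_singleton_eq_top.1 h)
  -- In dimension one an associated prime of `A / (t)` is the maximal ideal, which is thus `(t) : c`
  -- for some `c`. If no entry were a unit, all `v i * c / t` would lie in `A`, so `c / t` would as
  -- well, putting `1` in `P`.
  obtain ⟨P, hP, -⟩ := exists_le_isAssociatedPrime_of_isNoetherianRing A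
    (1 : A ⧸ Ideal.span {t}) one_ne_zero
  obtain ⟨hPp, x, hx⟩ := isAssociatedPrime_iff.1 hP
  obtain ⟨c, rfl⟩ := Ideal.Quotient.mk_surjective x
  have hmem : ∀ r, r ∈ P ↔ t ∣ r * c := by
    intro r
    rw [hx, Submodule.mem_colon_singleton, Submodule.mem_bot, ← Ideal.mem_span_singleton,
      ← Ideal.Quotient.eq_zero_iff_mem, map_mul]
    rfl
  have hPm : P = maximalIdeal A := by
    have htP : t ∈ P := (hmem t).2 (dvd_mul_right t c)
    have hPb : P ≠ ⊥ := fun h => ht0 (by rwa [h, Ideal.mem_bot] at htP)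
    exact eq_maximalIdeal (hPp.isMaximal_of_ne_bot hPb)
  have htK : algebraMap A K t ≠ 0 := by rwa [Ne, FaithfulSMul.algebraMap_eq_zero_iff]
  obtain ⟨e, he⟩ := (hv (algebraMap A K c / algebraMap A K t)).1 fun i => by
    obtain ⟨e, he⟩ := (hmem (v i)).1 (by rw [hPm]; exact (mem_maximalIdeal _).2 (hall i))
    refine ⟨e, ?_⟩
    have := congrArg (algebraMap A K) he
    rw [map_mul, map_mul] at this
    field_simp
    linear_combination -this
  refine hPp.ne_top ((Ideal.eq_top_iff_one _).2 ((hmem 1).2 ⟨e, ?_⟩))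
  apply IsFractionRing.injective A K
  rw [one_mul, map_mul, he]
  field_simp

/-! ### Regular functions inside the function field of an integral scheme. -/

namespace DetPres

section FunctionField

variable {X : Scheme.{u}} [AlgebraicGeometry.IsIntegral X]

/-- The rational function defined by a regular function on a nonempty open set. -/
noncomputable def toRational {U : X.Opens} (hU : Nonempty U) : Γ(X, U) →+* X.functionField :=
  (X.germToFunctionField U).hom

theorem toRational_injective {U : X.Opens} (hU : Nonempty U) :
    Function.Injective (toRational hU) :=
  Scheme.germToFunctionField_injective X U

theorem toRational_res {U V : X.Opens} (hU : Nonempty U) (hV : Nonempty V) (h : V ≤ U)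
    (f : Γ(X, U)) : toRational hV (res h f) = toRational hU f :=
  X.presheaf.germ_res_apply (homOfLE h) _ _ f

variable (X) in
/-- The local ring of `X` at `x`, as a subring of the function field. -/
noncomputable def localSubring (x : X) : Subring X.functionField :=
  (algebraMap (X.presheaf.stalk x) X.functionField).range

theorem toRational_mem {U : X.Opens} (hU : Nonempty U) (f : Γ(X, U)) (x : X) (hx : x ∈ U) :
    toRational hU f ∈ localSubring X x :=
  ⟨X.presheaf.germ U x hx f, Scheme.algebraMap_germ_eq_germToFunctionField _ hx f⟩

/-- The local representatives of `f` agree on overlaps, which are nonempty by irreducibility and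
whose functions inject into the function field; hence they glue. -/
theorem exists_toRational_eq {U : X.Opens} (hU : Nonempty U) (f : X.functionField)
    (hf : ∀ x ∈ U, f ∈ localSubring X x) : ∃ s, toRational hU s = f := by
  have hloc : ∀ x : U, ∃ (V : X.Opens) (_ : x.1 ∈ V) (_ : V ≤ U) (s : Γ(X, V)),
      ∀ hV : Nonempty V, toRational hV s = f := by
    intro x
    obtain ⟨g, hg⟩ := hf x.1 x.2
    obtain ⟨V, hxV, s, hs⟩ := X.presheaf.exists_germ_eq g
    refine ⟨V ⊓ U, ⟨hxV, x.2⟩, inf_le_right, res inf_le_left s, fun hV => ?_⟩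
    have hV' : Nonempty V := ⟨⟨x.1, hxV⟩⟩
    rw [toRational_res hV' hV, ← hg, ← hs]
    exact (Scheme.algebraMap_germ_eq_germToFunctionField _ hxV s).symm
  choose V hxV hVU s hs using hloc
  obtain ⟨t, ht, -⟩ := X.sheaf.existsUnique_gluing' V U (fun x => homOfLE (hVU x))
    (fun x hx => Opens.mem_iSup.2 ⟨⟨x, hx⟩, hxV ⟨x, hx⟩⟩) s (by
      intro x y
      have key : res (inf_le_left : V x ⊓ V y ≤ V x) (s x) = res inf_le_right (s y) := by
        have hx : Nonempty (V x) := ⟨⟨_, hxV x⟩⟩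
        have hy : Nonempty (V y) := ⟨⟨_, hxV y⟩⟩
        have hxy : Nonempty (V x ⊓ V y : X.Opens) := by
          have := nonempty_preirreducible_inter (V x).2 (V y).2 ⟨_, hxV x⟩ ⟨_, hxV y⟩
          exact this.to_subtype
        apply toRational_injective hxy
        rw [toRational_res hx, toRational_res hy, hs, hs]
      exact key)
  obtain ⟨x⟩ := hU
  have hx : Nonempty (V x) := ⟨⟨_, hxV x⟩⟩
  refine ⟨t, ?_⟩
  rw [← hs x hx, ← ht x]
  exact (toRational_res ⟨x⟩ hx (hVU x) t).symm

theorem isUnit_of_inv_mem {U : X.Opens} (hU : Nonempty U) (f : Γ(X, U))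
    (h0 : toRational hU f ≠ 0) (h : ∀ x ∈ U, (toRational hU f)⁻¹ ∈ localSubring X x) :
    IsUnit f := by
  obtain ⟨g, hg⟩ := exists_toRational_eq hU _ h
  refine IsUnit.of_mul_eq_one g (toRational_injective hU ?_)
  rw [map_mul, map_one, hg, mul_inv_cancel₀ h0]

end FunctionField

/-! ### Local factoriality and primitive vectors on smooth varieties. -/

theorem uniqueFactorizationMonoid_of_smooth {k R : Type u} [Field k] [IsAlgClosed k] [CommRing R]
    [IsDomain R] [Algebra k R] [Algebra.Smooth k R] (m : Ideal R) [m.IsMaximal] (A : Type u)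
    [CommRing A] [Algebra R A] [IsLocalization.AtPrime A m] : UniqueFactorizationMonoid A := by
  have : IsNoetherianRing R := Algebra.FiniteType.isNoetherianRing k R
  have : IsNoetherianRing A := IsLocalization.isNoetherianRing m.primeCompl A inferInstance
  have : IsLocalRing A := IsLocalization.AtPrime.isLocalRing A m
  have : IsDomain A := IsLocalization.isDomain_of_atPrime A m
  let _ : Algebra k A := ((algebraMap R A).comp (algebraMap k R)).toAlgebra
  have : IsScalarTower k R A := IsScalarTower.of_algebraMap_eq fun _ => rfl
  have : Algebra.FormallySmooth R A := Algebra.FormallySmooth.of_isLocalization m.primeCompl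
  have : Algebra.FormallySmooth k A := Algebra.FormallySmooth.comp k R A
  have : Infinite k := IsAlgClosed.instInfinite
  refine UniqueFactorizationMonoid.of_formallySmooth k ?_
  -- The residue field is a quotient of `R`, so it is a finitely generated `k`-algebra. By the
  -- Nullstellensatz it is finite over `k`, hence equal to `k`.
  have hsurj : Function.Surjective (algebraMap R (IsLocalRing.ResidueField A)) := by
    intro x
    obtain ⟨y, hy⟩ := (IsLocalization.AtPrime.equivQuotMaximalIdeal m A).surjective x
    obtain ⟨r, rfl⟩ := Ideal.Quotient.mk_surjective y
    exact ⟨r, hy⟩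
  have : Algebra.FiniteType k (IsLocalRing.ResidueField A) :=
    Algebra.FiniteType.of_surjective (IsScalarTower.toAlgHom k R (IsLocalRing.ResidueField A)) hsurj
  have : Module.Finite k (IsLocalRing.ResidueField A) := finite_of_finite_type_of_isJacobsonRing _ _
  exact (IsAlgClosed.algebraMap_bijective_of_isIntegral (k := k)).2

theorem smooth_scalar (k : Type u) [Field k] {X : Scheme.{u}} [X.Over (Spec (.of k))]
    (hsm : Smooth (X ↘ Spec (.of k))) {W : X.Opens} (hW : IsAffineOpen W) :
    (scalar k W).Smooth := by
  refine RingHom.Smooth.comp (RingHom.Smooth.of_bijective ?_) ?_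
  · exact (Scheme.ΓSpecIso (.of k)).symm.commRingCatIsoToRingEquiv.bijective
  · exact HasRingHomProperty.appLE @Smooth _ hsm ⟨⊤, isAffineOpen_top _⟩ ⟨W, hW⟩ _

section

variable {X : Scheme.{u}} [AlgebraicGeometry.IsIntegral X]

theorem localSubring_eq_localizationSet {W : X.Opens} (hW : IsAffineOpen W) [Nonempty W] (y : W) :
    (localSubring X y.1 : Set X.functionField) =
      localizationSet X.functionField (hW.primeIdealOf y).asIdeal := by
  let _ := TopCat.Presheaf.algebra_section_stalk X.presheaf y
  have := hW.isLocalization_stalk y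
  have := functionField_isScalarTower X W y
  exact range_eq_localizationSet (A := X.presheaf.stalk y.1) _

/-- On a smooth variety, every nonzero vector of rational functions becomes primitive near a given
point after division by a suitable rational function. -/
theorem exists_isPrimitive_nhds {k : Type u} [Field k] [IsAlgClosed k] [X.Over (Spec (.of k))]
    (hsm : Smooth (X ↘ Spec (.of k))) {ι : Type*} [Finite ι] (v : ι → X.functionField)
    (hv : ∃ i, v i ≠ 0) (x : X) :
    ∃ U : X.Opens, x ∈ U ∧ ∃ d : X.functionField, d ≠ 0 ∧
      ∀ y ∈ U, IsPrimitive (localSubring X y) fun i => v i / d := by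
  obtain ⟨_, ⟨W, hW, rfl⟩, hxW, -⟩ :=
    X.isBasis_affineOpens.exists_subset_of_mem_open (show x ∈ (⊤ : X.Opens) from trivial)
      (⊤ : X.Opens).isOpen
  have hne : Nonempty W := ⟨⟨x, hxW⟩⟩
  have hfrac := functionField_isFractionRing_of_isAffineOpen X W hW
  let _ : Algebra k Γ(X, W) := (scalar k W).toAlgebra
  have hsmooth : Algebra.Smooth k Γ(X, W) := smooth_scalar k hsm hW
  have hnoeth : IsNoetherianRing Γ(X, W) := Algebra.FiniteType.isNoetherianRing k _
  -- Factoriality was proved at closed points, so `x` is specialised to a closed point of `W`. The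
  -- neighbourhood found by spreading from there contains `x`, because the prime of `x` lies in `m`.
  obtain ⟨m, hm, hle⟩ := Ideal.exists_le_maximal _ (hW.primeIdealOf ⟨x, hxW⟩).2.ne_top
  have hp : hW.fromSpec ⟨m, hm.isPrime⟩ ∈ W := by
    have := Set.mem_range_self (f := hW.fromSpec) ⟨m, hm.isPrime⟩
    rwa [hW.range_fromSpec] at this
  let p : W := ⟨hW.fromSpec ⟨m, hm.isPrime⟩, hp⟩
  let _ : Algebra Γ(X, W) (X.presheaf.stalk p.1) :=
    TopCat.Presheaf.algebra_section_stalk X.presheaf p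
  have hloc : IsLocalization.AtPrime (X.presheaf.stalk p.1) m :=
    hW.isLocalization_stalk' ⟨m, hm.isPrime⟩ hp
  have := functionField_isScalarTower X W p
  have hufd : UniqueFactorizationMonoid (X.presheaf.stalk p.1) :=
    uniqueFactorizationMonoid_of_smooth (k := k) m _
  obtain ⟨d, hd, hprim⟩ := UniqueFactorizationMonoid.exists_isPrimitive
    (A := X.presheaf.stalk p.1) v hv
  rw [range_eq_localizationSet (A := X.presheaf.stalk p.1) m] at hprim
  obtain ⟨f, hf, hspread⟩ := hprim.exists_spread m _ (by
    obtain ⟨i, hi⟩ := hv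
    exact ⟨i, div_ne_zero hi hd⟩)
  have hmem : ∀ y : W, y.1 ∈ X.basicOpen f ↔ f ∉ (hW.primeIdealOf y).asIdeal := by
    intro y
    let _ := TopCat.Presheaf.algebra_section_stalk X.presheaf y
    have := hW.isLocalization_stalk y
    rw [X.mem_basicOpen' f y]
    exact IsLocalization.AtPrime.isUnit_to_map_iff (X.presheaf.stalk y.1)
      (hW.primeIdealOf y).asIdeal f
  refine ⟨X.basicOpen f, (hmem ⟨x, hxW⟩).2 fun h => hf (hle h), d, hd, fun y hy => ?_⟩
  have hyW : y ∈ W := X.basicOpen_le f hy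
  rw [localSubring_eq_localizationSet hW ⟨y, hyW⟩]
  exact hspread _ (hW.primeIdealOf ⟨y, hyW⟩).2 ((hmem ⟨y, hyW⟩).1 hy)

/-- A primitive vector of regular functions generates the unit ideal at a point of
codimension one. -/
theorem exists_mem_basicOpen_of_isPrimitive {k : Type u} [Field k] [X.Over (Spec (.of k))]
    (hsm : Smooth (X ↘ Spec (.of k))) {ι : Type*} {U : X.Opens} (hU : Nonempty U)
    (f : ι → Γ(X, U)) (x : X) (hx : x ∈ U) (hcodim : Order.coheight x = 1)
    (hf : IsPrimitive (localSubring X x) fun i => toRational hU (f i)) :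
    ∃ i, x ∈ X.basicOpen (f i) := by
  obtain ⟨_, ⟨W, hW, rfl⟩, hxW, -⟩ :=
    X.isBasis_affineOpens.exists_subset_of_mem_open (show x ∈ (⊤ : X.Opens) from trivial)
      (⊤ : X.Opens).isOpen
  let _ : Algebra k Γ(X, W) := (scalar k W).toAlgebra
  have hsmooth : Algebra.Smooth k Γ(X, W) := smooth_scalar k hsm hW
  have hnoeth : IsNoetherianRing Γ(X, W) := Algebra.FiniteType.isNoetherianRing k _
  let _ := TopCat.Presheaf.algebra_section_stalk X.presheaf ⟨x, hxW⟩
  have := hW.isLocalization_stalk ⟨x, hxW⟩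
  have : IsNoetherianRing (X.presheaf.stalk x) :=
    IsLocalization.isNoetherianRing (hW.primeIdealOf ⟨x, hxW⟩).asIdeal.primeCompl _ hnoeth
  have : Ring.KrullDimLE 1 (X.presheaf.stalk x) := krullDimLE_of_coheight_le hcodim.le
  have hfield : ¬ IsField (X.presheaf.stalk x) := by
    intro h
    have h1 := ringKrullDim_stalk_eq_coheight x
    rw [ringKrullDim_eq_zero_of_isField h, hcodim] at h1
    exact absurd h1 (by norm_cast)
  obtain ⟨i, hi⟩ := IsPrimitive.exists_isUnit (K := X.functionField) hfield
    (v := fun i => X.presheaf.germ U x hx (f i)) (by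
      have h1 : ∀ i, algebraMap (X.presheaf.stalk x) X.functionField
          (X.presheaf.germ U x hx (f i)) = toRational hU (f i) :=
        fun i => Scheme.algebraMap_germ_eq_germToFunctionField _ hx (f i)
      simp only [h1]
      exact hf)
  exact ⟨i, (X.mem_basicOpen _ _ hx).2 hi⟩

end

/-! ### Line bundles, sections and morphisms expressed through rational functions. -/

section

/-- Cocycle conditions range over all opens, including the empty one, where no map to the function
field is available. -/
theorem section_eq_of_isEmpty {X : Scheme.{u}} {W : X.Opens} (hW : ¬ Nonempty W) (f g : Γ(X, W)) :
    f = g :=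
  X.sheaf.eq_of_locally_eq' (fun i : Empty => i.elim) W (fun i => i.elim)
    (fun x hx => absurd ⟨⟨x, hx⟩⟩ hW) f g fun i => i.elim

variable {X : Scheme.{u}} [AlgebraicGeometry.IsIntegral X]

theorem nonempty_inf {U V : X.Opens} (hU : Nonempty U) (hV : Nonempty V) :
    Nonempty (U ⊓ V : X.Opens) := by
  obtain ⟨x⟩ := hU
  obtain ⟨y⟩ := hV
  exact (nonempty_preirreducible_inter U.2 V.2 ⟨_, x.2⟩ ⟨_, y.2⟩).to_subtype

theorem section_ext_toRational {W : X.Opens} (f g : Γ(X, W))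
    (h : ∀ hW : Nonempty W, toRational hW f = toRational hW g) : f = g := by
  by_cases hW : Nonempty W
  · exact toRational_injective hW (h hW)
  · exact section_eq_of_isEmpty hW f g

variable (X) in
/-- The constant rational functions. -/
noncomputable def rationalScalar (k : Type u) [Field k] [X.Over (Spec (.of k))] :
    k →+* X.functionField :=
  have : Nonempty (⊤ : X.Opens) := (inferInstance : Nonempty X).map fun x => ⟨x, trivial⟩
  (toRational this).comp (scalar k ⊤)

theorem toRational_scalar {k : Type u} [Field k] [X.Over (Spec (.of k))] {U : X.Opens}
    (hU : Nonempty U) (c : k) : toRational hU (scalar k U c) = rationalScalar X k c := by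
  have : Nonempty (⊤ : X.Opens) := hU.map fun x => ⟨x.1, trivial⟩
  rw [← res_scalar k (le_top : U ≤ ⊤), toRational_res this hU]
  rfl

theorem toRational_res_mul_res {U V W : X.Opens} (hU : Nonempty U) (hV : Nonempty V)
    (hW : Nonempty W) (h : W ≤ U) (h' : W ≤ V) (f : Γ(X, U)) (g : Γ(X, V)) :
    toRational hW (res h f * res h' g) = toRational hU f * toRational hV g := by
  rw [map_mul, toRational_res hU, toRational_res hV]

namespace LineBundle

/-- A rational trivialisation of a line bundle: rational functions whose ratios are the
transition functions. -/
structure Frame (L : LineBundle X) where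
  base : L.I
  ne : ∀ i, Nonempty (L.U i)
  fn : L.I → X.functionField
  fn_ne_zero : ∀ i, fn i ≠ 0
  toRational_g : ∀ i j, toRational (nonempty_inf (ne i) (ne j)) (L.g i j) = fn j / fn i

namespace Frame

variable {L L' : LineBundle X} (F : Frame L) (F' : Frame L')

/-- The rational function corresponding to a global section. -/
noncomputable def val (s : L.H0) : X.functionField :=
  toRational (F.ne F.base) (s.1 F.base) * F.fn F.base

/-- The gluing rule together with `g i j = fn j / fn i` makes `s i * fn i` independent of the chart.
-/
theorem val_eq (s : L.H0) (i : L.I) : F.val s = toRational (F.ne i) (s.1 i) * F.fn i := by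
  have h := congrArg (toRational (nonempty_inf (F.ne F.base) (F.ne i))) (s.2 F.base i)
  rw [map_mul, toRational_res (F.ne _), toRational_res (F.ne _), F.toRational_g] at h
  rw [val, h]
  have := F.fn_ne_zero F.base
  field_simp

theorem toRational_apply (s : L.H0) (i : L.I) :
    toRational (F.ne i) (s.1 i) = F.val s / F.fn i := by
  rw [F.val_eq s i, mul_div_cancel_right₀ _ (F.fn_ne_zero i)]

theorem val_injective : Function.Injective F.val := by
  intro s t h
  refine Subtype.ext (funext fun i => toRational_injective (F.ne i) ?_)
  rw [F.toRational_apply, F.toRational_apply, h]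

theorem val_add (s t : L.H0) : F.val (s + t) = F.val s + F.val t := by
  simp only [val, ← add_mul, ← map_add]
  rfl

theorem val_zero : F.val 0 = 0 := by
  have := F.val_add 0 0
  rwa [add_zero, left_eq_add] at this

theorem val_sum {ι : Type*} (I : Finset ι) (s : ι → L.H0) :
    F.val (∑ i ∈ I, s i) = ∑ i ∈ I, F.val (s i) :=
  map_sum (⟨⟨F.val, F.val_zero⟩, F.val_add⟩ : L.H0 →+ X.functionField) s I

theorem val_smul {k : Type u} [Field k] [X.Over (Spec (.of k))] (c : k) (s : L.H0) :
    F.val (c • s) = rationalScalar X k c * F.val s := by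
  rw [val, H0.smul_val, map_mul, toRational_scalar, mul_assoc]
  rfl

theorem exists_val_eq (σ : X.functionField)
    (h : ∀ i, ∀ x ∈ L.U i, σ / F.fn i ∈ localSubring X x) : ∃ s, F.val s = σ := by
  choose s hs using fun i => exists_toRational_eq (F.ne i) _ (h i)
  refine ⟨⟨s, fun i j => ?_⟩, ?_⟩
  · refine toRational_injective (nonempty_inf (F.ne i) (F.ne j)) ?_
    rw [map_mul, toRational_res (F.ne i), toRational_res (F.ne j), hs, hs, F.toRational_g]
    have := F.fn_ne_zero i
    have := F.fn_ne_zero j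
    field_simp
  · rw [val, hs, div_mul_cancel₀ _ (F.fn_ne_zero _)]

/-- The product of two rational trivialisations. -/
noncomputable def tensor : Frame (L.tensor L') where
  base := (F.base, F'.base)
  ne p := nonempty_inf (F.ne p.1) (F'.ne p.2)
  fn p := F.fn p.1 * F'.fn p.2
  fn_ne_zero p := mul_ne_zero (F.fn_ne_zero _) (F'.fn_ne_zero _)
  toRational_g p q := by
    obtain ⟨i, i'⟩ := p
    obtain ⟨j, j'⟩ := q
    refine (toRational_res_mul_res (nonempty_inf (F.ne i) (F.ne j))
      (nonempty_inf (F'.ne i') (F'.ne j')) _ _ _ _ _).trans ?_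
    rw [mul_div_mul_comm, F.toRational_g, F'.toRational_g]

theorem val_mulSection (s : L.H0) (t : L'.H0) :
    (F.tensor F').val (mulSection s t) = F.val s * F'.val t := by
  refine (congrArg (· * _) (toRational_res_mul_res (F.ne F.base) (F'.ne F'.base) _ _ _ _ _)).trans
    (mul_mul_mul_comm _ _ _ _)

/-- The inverse of a rational trivialisation. -/
noncomputable def dual : Frame L.dual where
  base := F.base
  ne := F.ne
  fn i := (F.fn i)⁻¹
  fn_ne_zero i := inv_ne_zero (F.fn_ne_zero i)
  toRational_g i j := by
    exact (toRational_res (nonempty_inf (F.ne j) (F.ne i)) _ _ _).trans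
      ((F.toRational_g j i).trans (inv_div_inv _ _).symm)

/-- The morphism `φ` is multiplication by the rational function `c`. -/
def HasScale (φ : Hom L L') (c : X.functionField) : Prop :=
  ∀ j i, toRational (nonempty_inf (F'.ne j) (F.ne i)) (φ.c j i) = c * F.fn i / F'.fn j

variable {F F'}

theorem HasScale.val_map {φ : Hom L L'} {c : X.functionField} (h : HasScale F F' φ c)
    (s : L.H0) : F'.val (φ.map s) = c * F.val s := by
  have e := congrArg (toRational (nonempty_inf (F'.ne F'.base) (F.ne F.base)))
    (φ.map_spec s F'.base F.base)
  rw [map_mul, toRational_res (F'.ne _), toRational_res (F.ne _), h, F.toRational_apply,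
    F'.toRational_apply] at e
  have := F.fn_ne_zero F.base
  have := F'.fn_ne_zero F'.base
  field_simp at e
  exact e

variable (F F') in
-- In terms of frames the compatibility of a morphism is an identity in the function field, so only
-- regularity of the local factors has to be supplied.
theorem exists_hasScale (c : X.functionField)
    (h : ∀ j i, ∀ x ∈ L'.U j ⊓ L.U i, c * F.fn i / F'.fn j ∈ localSubring X x) :
    ∃ φ : Hom L L', HasScale F F' φ c := by
  choose f hf using fun j i =>
    exists_toRational_eq (nonempty_inf (F'.ne j) (F.ne i)) _ (h j i)
  refine ⟨⟨f, fun j j' i i' W h₁ h₂ hi hj => section_ext_toRational _ _ fun hW => ?_⟩, hf⟩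
  rw [map_mul, map_mul, toRational_res (nonempty_inf (F'.ne j) (F.ne i)),
    toRational_res (nonempty_inf (F'.ne j') (F.ne i')),
    toRational_res (nonempty_inf (F.ne i) (F.ne i')),
    toRational_res (nonempty_inf (F'.ne j) (F'.ne j')), hf, hf, F.toRational_g, F'.toRational_g]
  have := F.fn_ne_zero i
  have := F'.fn_ne_zero j
  have := F'.fn_ne_zero j'
  field_simp

theorem HasScale.isIso {φ : Hom L L'} {c : X.functionField} (h : HasScale F F' φ c) (hc : c ≠ 0)
    (hinv : ∀ j i, ∀ x ∈ L'.U j ⊓ L.U i, (c * F.fn i / F'.fn j)⁻¹ ∈ localSubring X x) :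
    φ.IsIso := by
  intro j i
  refine isUnit_of_inv_mem (nonempty_inf (F'.ne j) (F.ne i)) _ ?_ ?_
  · rw [h]
    exact div_ne_zero (mul_ne_zero hc (F.fn_ne_zero _)) (F'.fn_ne_zero _)
  · rw [h]
    exact hinv j i

end Frame

/-- The line bundle with a prescribed rational trivialisation. -/
noncomputable def ofRational {I : Type u} (U : I → X.Opens) (hU : ∀ i, Nonempty (U i))
    (cover : ⨆ i, U i = ⊤) (d : I → X.functionField) (hd : ∀ i, d i ≠ 0)
    (h : ∀ i j, ∀ x ∈ U i ⊓ U j, d j / d i ∈ localSubring X x) : LineBundle X :=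
  have spec i j := (exists_toRational_eq (nonempty_inf (hU i) (hU j)) _ (h i j)).choose_spec
  { I := I
    U := U
    cover := cover
    g i j := (exists_toRational_eq (nonempty_inf (hU i) (hU j)) _ (h i j)).choose
    g_self i := by
      refine toRational_injective (nonempty_inf (hU i) (hU i)) ?_
      rw [spec, map_one, div_self (hd i)]
    g_mul i j l W h₁ h₂ h₃ := by
      refine section_ext_toRational _ _ fun hW => ?_
      rw [map_mul, toRational_res (nonempty_inf (hU i) (hU j)),
        toRational_res (nonempty_inf (hU j) (hU l)),
        toRational_res (nonempty_inf (hU i) (hU l)), spec, spec, spec]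
      have := hd i
      have := hd j
      field_simp }

/-- The tautological rational trivialisation of `ofRational`. -/
noncomputable def ofRationalFrame {I : Type u} (i₀ : I) (U : I → X.Opens)
    (hU : ∀ i, Nonempty (U i)) (cover : ⨆ i, U i = ⊤) (d : I → X.functionField)
    (hd : ∀ i, d i ≠ 0) (h : ∀ i j, ∀ x ∈ U i ⊓ U j, d j / d i ∈ localSubring X x) :
    Frame (ofRational U hU cover d hd h) where
  base := i₀
  ne := hU
  fn := d
  fn_ne_zero := hd
  toRational_g i j :=
    (exists_toRational_eq (nonempty_inf (hU i) (hU j)) _ (h i j)).choose_spec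

/-- The rational trivialisation of a line bundle obtained by restricting to one chart. -/
noncomputable def frameOfNonempty (L : LineBundle X) (i₀ : L.I) (hL : ∀ i, Nonempty (L.U i)) :
    Frame L :=
  have hmul i j : toRational (nonempty_inf (hL i₀) (hL i)) (L.g i₀ i) *
      toRational (nonempty_inf (hL i) (hL j)) (L.g i j) =
      toRational (nonempty_inf (hL i₀) (hL j)) (L.g i₀ j) := by
    have hW := nonempty_inf (nonempty_inf (hL i₀) (hL i)) (hL j)
    have e := congrArg (toRational hW) (L.g_mul i₀ i j (L.U i₀ ⊓ L.U i ⊓ L.U j) inf_le_left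
      (inf_le_inf_right _ inf_le_right) (inf_le_inf_right _ inf_le_left))
    rwa [map_mul, toRational_res (nonempty_inf (hL i₀) (hL i)),
      toRational_res (nonempty_inf (hL i) (hL j)),
      toRational_res (nonempty_inf (hL i₀) (hL j))] at e
  have hne i : toRational (nonempty_inf (hL i₀) (hL i)) (L.g i₀ i) ≠ 0 := by
    intro h0
    have e := hmul i i₀
    rw [h0, zero_mul, L.g_self, map_one] at e
    exact zero_ne_one e
  { base := i₀
    ne := hL
    fn i := toRational (nonempty_inf (hL i₀) (hL i)) (L.g i₀ i)
    fn_ne_zero := hne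
    toRational_g i j := by rw [← hmul i j, mul_div_cancel_left₀ _ (hne i)] }

/-- The rational trivialisation of `𝒪_X(B)` in which the defining section is `1`. -/
noncomputable def divisorFrame (B : EffectiveDivisor X) (b₀ : B.I) (hB : ∀ b, Nonempty (B.U b)) :
    Frame B.lineBundle :=
  have hne b : toRational (hB b) (B.f b) ≠ 0 := by
    intro h0
    have := B.regular b (B.U b) le_rfl
    rw [res_self, (map_eq_zero_iff _ (toRational_injective (hB b))).1 h0] at this
    exact zero_notMem_nonZeroDivisors (M₀ := Γ(X, B.U b)) this
  { base := b₀
    ne := hB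
    fn b := (toRational (hB b) (B.f b))⁻¹
    fn_ne_zero b := inv_ne_zero (hne b)
    toRational_g i j := by
      have e := congrArg (toRational (nonempty_inf (hB i) (hB j))) (B.ratio_spec i j)
      rw [map_mul, toRational_res (hB i), toRational_res (hB j)] at e
      rw [inv_div_inv, e, mul_div_cancel_right₀ _ (hne j)]
      rfl }

/-- The frame of `𝒪_X(B)` gives the defining section the value `1`, so multiplying by it leaves the
rational function of a section unchanged. -/
theorem hasScale_mulDefiningSection {L : LineBundle X} (F : Frame L) (B : EffectiveDivisor X)
    (b₀ : B.I) (hB : ∀ b, Nonempty (B.U b)) :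
    Frame.HasScale (F.tensor (divisorFrame B b₀ hB).dual) F (L.mulDefiningSection B) 1 := by
  intro j p
  obtain ⟨i, b⟩ := p
  refine (toRational_res_mul_res (nonempty_inf (F.ne j) (F.ne i)) (hB b) _ _ _ _ _).trans ?_
  change _ = 1 * (F.fn i * ((toRational (hB b) (B.f b))⁻¹)⁻¹) / F.fn j
  rw [inv_inv, F.toRational_g]
  ring

end LineBundle

end

/-! ### Constants, linear fractions and vanishing on the charts of projective space. -/

theorem pull_ΓSpecIso_inv {Y : Scheme.{u}} {R : CommRingCat.{u}} (p : Y ⟶ Spec R) (U : Y.Opens)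
    (φ : R ⟶ Γ(Y, U)) (h : U.ι ≫ p = U.toSpecΓ ≫ Spec.map φ) (c : R) :
    pull p (U := ⊤) (V := U) (fun _ _ => trivial) ((Scheme.ΓSpecIso R).inv c) = φ c := by
  have e : (Scheme.ΓSpecIso R).inv ≫ p.appLE ⊤ U (fun _ _ => trivial) = φ := by
    have h1 := congrArg (fun q => (Scheme.ΓSpecIso R).inv ≫ Scheme.Hom.appTop q) h
    simp only [Scheme.Hom.comp_appTop, Scheme.Opens.toSpecΓ_appTop,
      ← Scheme.ΓSpecIso_inv_naturality_assoc] at h1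
    have h2 : p.appLE ⊤ U (fun _ _ => trivial) ≫ U.topIso.inv = p.appTop ≫ U.ι.appTop :=
      (Category.assoc _ _ _).trans
        (congrArg (p.appTop ≫ ·) ((Y.presheaf.map_comp _ _).symm.trans U.ι_appTop.symm))
    rw [← cancel_mono U.topIso.inv, Category.assoc, h2]
    simpa using h1
  exact congrArg (fun q => q.hom c) e

theorem isUnit_localizationMk_iff {R : Type*} [CommRing R] (I : Ideal R) [I.IsPrime] (p : R)
    (q : I.primeCompl) : IsUnit (Localization.mk p q) ↔ p ∉ I := by
  rw [Localization.mk_eq_mk', IsLocalization.AtPrime.isUnit_mk'_iff _ I]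
  rfl

section PSpace

attribute [local instance] MvPolynomial.gradedAlgebra

variable {k : Type u} [Field k] {r : ℕ}

/-- On a chart the structure morphism comes from a ring map out of `k`. This allows constants of the
scheme to be compared with constant polynomials, and makes `l ↦ l / x_i` linear over `k`. -/
theorem PSpace.ι_toSpec (i : Fin (r + 1)) :
    (PSpace.chart k r i).ι ≫ PSpace.toSpec k r = (PSpace.chart k r i).toSpecΓ ≫
      Spec.map (CommRingCat.ofHom (algebraMap k (MvPolynomial.homogeneousSubmodule (Fin (r + 1)) k 0)) ≫
        CommRingCat.ofHom (HomogeneousLocalization.fromZeroRingHom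
          (MvPolynomial.homogeneousSubmodule (Fin (r + 1)) k) _) ≫
        Proj.awayToSection (MvPolynomial.homogeneousSubmodule (Fin (r + 1)) k)
          (MvPolynomial.X i)) := by
  have h := Proj.awayι_toSpecZero (MvPolynomial.homogeneousSubmodule (Fin (r + 1)) k)
    _ (PSpace.X_mem (k := k) i) one_pos
  rw [Proj.awayι, Category.assoc, Iso.inv_comp_eq, Proj.basicOpenIsoSpec_hom,
    Proj.basicOpenToSpec] at h
  rw [PSpace.toSpec, reassoc_of% h]
  simp

theorem PSpace.scalar_apply (i : Fin (r + 1)) (c : k) (x : PSpace k r)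
    (hx : x ∈ PSpace.chart k r i) :
    ((pull (PSpace.toSpec k r) (U := ⊤) (V := PSpace.chart k r i) (fun _ _ => trivial)
      ((Scheme.ΓSpecIso (.of k)).inv c)).1 ⟨x, hx⟩).val =
      Localization.mk (MvPolynomial.C c) 1 := by
  rw [pull_ΓSpecIso_inv _ _ _ (PSpace.ι_toSpec i)]
  refine (ProjectiveSpectrum.Proj.awayToSection_apply _ _ _ _).trans ?_
  have : HomogeneousLocalization.val (HomogeneousLocalization.fromZeroRingHom
      (MvPolynomial.homogeneousSubmodule (Fin (r + 1)) k) (Submonoid.powers (MvPolynomial.X i))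
      (algebraMap k (MvPolynomial.homogeneousSubmodule (Fin (r + 1)) k 0) c)) =
      Localization.mk (MvPolynomial.C c) 1 := rfl
  refine (congrArg _ this).trans ?_
  rw [Localization.mk_eq_mk', IsLocalization.map_mk', Localization.mk_eq_mk']
  rfl

theorem PSpace.frac_C_mul (i : Fin (r + 1)) (c : k) (l : MvPolynomial (Fin (r + 1)) k)
    (hl : l ∈ MvPolynomial.homogeneousSubmodule (Fin (r + 1)) k 1)
    (hl' : MvPolynomial.C c * l ∈ MvPolynomial.homogeneousSubmodule (Fin (r + 1)) k 1) :
    PSpace.frac i (MvPolynomial.C c * l) hl' =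
      pull (PSpace.toSpec k r) (U := ⊤) (V := PSpace.chart k r i) (fun _ _ => trivial)
        ((Scheme.ΓSpecIso (.of k)).inv c) * PSpace.frac i l hl := by
  refine PSpace.section_ext _ _ fun x hx => ?_
  refine Eq.trans ?_ (HomogeneousLocalization.val_mul _ _).symm
  refine Eq.trans ?_ (congrArg₂ (· * ·) (PSpace.scalar_apply i c x hx)
    (PSpace.frac_apply i l hl x hx)).symm
  rw [PSpace.frac_apply]
  rw [Localization.mk_mul, one_mul]

theorem PSpace.frac_add (i : Fin (r + 1)) (l l' : MvPolynomial (Fin (r + 1)) k)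
    (hl : l ∈ MvPolynomial.homogeneousSubmodule (Fin (r + 1)) k 1)
    (hl' : l' ∈ MvPolynomial.homogeneousSubmodule (Fin (r + 1)) k 1) :
    PSpace.frac i (l + l') (add_mem hl hl') = PSpace.frac i l hl + PSpace.frac i l' hl' := by
  refine PSpace.section_ext _ _ fun x hx => ?_
  refine Eq.trans ?_ (HomogeneousLocalization.val_add _ _).symm
  refine Eq.trans ?_ (congrArg₂ (· + ·) (PSpace.frac_apply i l hl x hx)
    (PSpace.frac_apply i l' hl' x hx)).symm
  rw [PSpace.frac_apply]
  exact (Localization.add_mk_self _ _ _).symm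

theorem PSpace.mem_basicOpen_iff {U : (PSpace k r).Opens} (f : Γ(PSpace k r, U)) (x : PSpace k r)
    (hx : x ∈ U) : x ∈ (PSpace k r).basicOpen f ↔ IsUnit (f.1 ⟨x, hx⟩).val := by
  have hp : x.asHomogeneousIdeal.toIdeal.IsPrime := x.isPrime
  rw [Scheme.mem_basicOpen _ _ _ hx]
  refine Iff.trans ?_
    (@HomogeneousLocalization.isUnit_iff_isUnit_val _ _ _ _ _ _
      (MvPolynomial.homogeneousSubmodule (Fin (r + 1)) k) _ _ _ x.asHomogeneousIdeal.toIdeal x.isPrime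
      _).symm
  have h := Proj.stalkIso'_germ (MvPolynomial.homogeneousSubmodule (Fin (r + 1)) k) U x hx f
  rw [← h]
  exact (MulEquiv.isUnit_map (Proj.stalkIso'
    (MvPolynomial.homogeneousSubmodule (Fin (r + 1)) k) x)).symm

theorem PSpace.mem_basicOpen_iff_notMem {U : (PSpace k r).Opens} (f : Γ(PSpace k r, U))
    (x : PSpace k r) (hx : x ∈ U) (p q : MvPolynomial (Fin (r + 1)) k)
    (hq : q ∉ x.asHomogeneousIdeal.toIdeal)
    (h : (f.1 ⟨x, hx⟩).val = Localization.mk p ⟨q, hq⟩) :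
    x ∈ (PSpace k r).basicOpen f ↔ p ∉ x.asHomogeneousIdeal.toIdeal := by
  rw [PSpace.mem_basicOpen_iff f x hx, h]
  exact @isUnit_localizationMk_iff _ _ _ x.isPrime p ⟨q, hq⟩

end PSpace

theorem mem_basicOpen_pull {X Y : Scheme.{u}} (p : X ⟶ Y) {U : Y.Opens} {V : X.Opens}
    (e : V ≤ p ⁻¹ᵁ U) (f : Γ(Y, U)) (x : X) (hx : x ∈ V) :
    x ∈ X.basicOpen (pull p e f) ↔ p x ∈ Y.basicOpen f := by
  rw [pull]
  erw [Scheme.basicOpen_appLE]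
  exact ⟨fun h => h.2, fun h => ⟨hx, h⟩⟩

/-- A function on a reduced scheme that vanishes at every point is zero. This is the bridge between
equations on `X` and the ideal of `X`, whose membership is a pointwise condition. -/
theorem pull_eq_zero_iff {X Y : Scheme.{u}} [IsReduced X] (p : X ⟶ Y) {U : Y.Opens} {V : X.Opens}
    (e : V ≤ p ⁻¹ᵁ U) (f : Γ(Y, U)) :
    pull p e f = 0 ↔ ∀ x ∈ V, p x ∉ Y.basicOpen f := by
  rw [← basicOpen_eq_bot_iff]
  constructor
  · intro h x hx hf
    rw [← mem_basicOpen_pull p e f x hx, h] at hf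
    exact hf
  · intro h
    rw [eq_bot_iff]
    intro x hx
    have hxV : x ∈ V := X.basicOpen_le _ hx
    exact h x hxV ((mem_basicOpen_pull p e f x hxV).1 hx)

theorem localizationMk_mul_sub_mul {R : Type*} [CommRing R] {M : Submonoid R} (a b c d : R)
    (q : M) : Localization.mk a q * Localization.mk b q - Localization.mk c q * Localization.mk d q =
      Localization.mk (a * b - c * d) (q * q) := by
  rw [Localization.mk_mul, Localization.mk_mul, sub_eq_add_neg, Localization.neg_mk,
    Localization.add_mk_self, ← sub_eq_add_neg]

attribute [local instance] MvPolynomial.gradedAlgebra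

/-! ### Linear forms as rational functions on `X`. -/

namespace ProjectiveVariety

variable {k : Type u} [Field k] {r : ℕ} (X : ProjectiveVariety k r)

instance : AlgebraicGeometry.IsIntegral X.carrier := X.isIntegral

theorem mem_ideal_iff (p : MvPolynomial (Fin (r + 1)) k) :
    p ∈ X.ideal ↔ ∀ x, p ∈ (X.emb x).asHomogeneousIdeal.toIdeal := by
  refine (ProjectiveSpectrum.mem_vanishingIdeal _ _).trans ?_
  exact ⟨fun h x => h _ ⟨x, rfl⟩, by rintro h _ ⟨x, rfl⟩; exact h x⟩

theorem scalar_eq (U : X.carrier.Opens) {i : Fin (r + 1)} (hU : U ≤ X.emb ⁻¹ᵁ PSpace.chart k r i)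
    (c : k) : scalar k U c = pull X.emb hU (pull (PSpace.toSpec k r) (U := ⊤)
      (V := PSpace.chart k r i) (fun _ _ => trivial) ((Scheme.ΓSpecIso (.of k)).inv c)) := by
  refine (congrArg (fun q => q.hom ((Scheme.ΓSpecIso (.of k)).inv c))
    (Scheme.Hom.appLE_comp_appLE X.emb (PSpace.toSpec k r) ⊤ (PSpace.chart k r i) U
      (fun _ _ => trivial) hU)).symm

/-- Restriction of linear forms to `X`, as a linear map. -/
noncomputable def linearRestriction :
    MvPolynomial.homogeneousSubmodule (Fin (r + 1)) k 1 →ₗ[k] X.O1.H0 where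
  toFun l := X.restrictLinear l l.2
  map_add' l l' := by
    refine Subtype.ext (funext fun i => ?_)
    exact (congrArg (pull X.emb _) (PSpace.frac_add i.down l.1 l'.1 l.2 l'.2)).trans (map_add _ _ _)
  map_smul' c l := by
    refine Subtype.ext (funext fun i => ?_)
    rw [RingHom.id_apply, LineBundle.H0.smul_val]
    have h : MvPolynomial.C c * l.1 ∈ MvPolynomial.homogeneousSubmodule (Fin (r + 1)) k 1 := by
      rw [← MvPolynomial.smul_eq_C_mul]
      exact Submodule.smul_mem _ c l.2
    have e : PSpace.frac i.down (c • l.1) (Submodule.smul_mem _ c l.2) =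
        PSpace.frac i.down (MvPolynomial.C c * l.1) h := by
      congr 1
      exact MvPolynomial.smul_eq_C_mul _ _
    refine (congrArg (pull X.emb _) (e.trans (PSpace.frac_C_mul i.down c l.1 l.2 h))).trans ?_
    refine (map_mul _ _ _).trans ?_
    congr 1
    exact (X.scalar_eq _ _ c).symm

theorem mem_ideal_of_restrictLinear_eq_zero (l : MvPolynomial (Fin (r + 1)) k)
    (hl : l ∈ MvPolynomial.homogeneousSubmodule (Fin (r + 1)) k 1)
    (h : X.restrictLinear l hl = 0) : l ∈ X.ideal := by
  rw [mem_ideal_iff]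
  intro x
  have hx : X.emb x ∈ ⨆ i, PSpace.chart k r i := by rw [PSpace.iSup_chart]; trivial
  obtain ⟨i, hi⟩ := Opens.mem_iSup.1 hx
  have h0 : pull X.emb (V := X.emb ⁻¹ᵁ PSpace.chart k r i) le_rfl (PSpace.frac i l hl) = 0 :=
    congrFun (congrArg Subtype.val h) ⟨i⟩
  have h1 := (pull_eq_zero_iff _ _ _).1 h0 x hi
  rw [PSpace.mem_basicOpen_iff_notMem _ _ hi _ _ hi (PSpace.frac_apply i l hl _ hi)] at h1
  exact not_not.1 h1

theorem pull_frac_mul_eq (i : Fin (r + 1)) (l₁ l₂ l₃ l₄ : MvPolynomial (Fin (r + 1)) k)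
    (h₁ : l₁ ∈ MvPolynomial.homogeneousSubmodule (Fin (r + 1)) k 1)
    (h₂ : l₂ ∈ MvPolynomial.homogeneousSubmodule (Fin (r + 1)) k 1)
    (h₃ : l₃ ∈ MvPolynomial.homogeneousSubmodule (Fin (r + 1)) k 1)
    (h₄ : l₄ ∈ MvPolynomial.homogeneousSubmodule (Fin (r + 1)) k 1)
    (h : l₁ * l₂ - l₃ * l₄ ∈ X.ideal) {V : X.carrier.Opens}
    (hV : V ≤ X.emb ⁻¹ᵁ PSpace.chart k r i) :
    pull X.emb hV (PSpace.frac i l₁ h₁) * pull X.emb hV (PSpace.frac i l₂ h₂) =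
      pull X.emb hV (PSpace.frac i l₃ h₃) * pull X.emb hV (PSpace.frac i l₄ h₄) := by
  rw [← sub_eq_zero, ← map_mul, ← map_mul, ← map_sub, pull_eq_zero_iff]
  intro x hx
  have hi : X.emb x ∈ PSpace.chart k r i := hV hx
  have hp : (X.emb x).asHomogeneousIdeal.toIdeal.IsPrime := (X.emb x).isPrime
  have hq : (MvPolynomial.X i : MvPolynomial (Fin (r + 1)) k) * MvPolynomial.X i ∉
      (X.emb x).asHomogeneousIdeal.toIdeal := fun h => (hp.mem_or_mem h).elim hi hi
  rw [PSpace.mem_basicOpen_iff_notMem _ _ hi _ _ hq, not_not]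
  · exact (X.mem_ideal_iff _).1 h x
  · refine (HomogeneousLocalization.val_sub _ _).trans ?_
    refine (congrArg₂ (· - ·) ((HomogeneousLocalization.val_mul _ _).trans (congrArg₂ (· * ·)
      (PSpace.frac_apply i l₁ h₁ _ hi) (PSpace.frac_apply i l₂ h₂ _ hi)))
      ((HomogeneousLocalization.val_mul _ _).trans (congrArg₂ (· * ·)
      (PSpace.frac_apply i l₃ h₃ _ hi) (PSpace.frac_apply i l₄ h₄ _ hi)))).trans ?_
    exact localizationMk_mul_sub_mul _ _ _ _ _

/-- An empty chart would put `x_i` in the ideal, against nondegeneracy. A `Frame` needs all charts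
to be nonempty. -/
theorem nonempty_chart (hnd : X.IsNondegenerate) (i : X.O1.I) : Nonempty (X.O1.U i) := by
  by_contra h
  refine MvPolynomial.X_ne_zero i.down (hnd _ (PSpace.X_mem i.down) ?_)
  rw [mem_ideal_iff]
  intro x
  by_contra hx
  exact h ⟨⟨x, hx⟩⟩

/-- The rational trivialisation of `𝒪_X(1)` by `x₀`. -/
noncomputable def O1Frame (hnd : X.IsNondegenerate) : LineBundle.Frame X.O1 :=
  LineBundle.frameOfNonempty X.O1 ⟨0⟩ (X.nonempty_chart hnd)

/-- The rational function `l / x₀` on `X`, as a linear function of the linear form `l`. -/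
noncomputable def ratio (hnd : X.IsNondegenerate)
    (l : MvPolynomial.homogeneousSubmodule (Fin (r + 1)) k 1) : X.carrier.functionField :=
  (X.O1Frame hnd).val (X.linearRestriction l)

variable (hnd : X.IsNondegenerate)

theorem ratio_ne_zero (l : MvPolynomial.homogeneousSubmodule (Fin (r + 1)) k 1)
    (hl : l ≠ 0) : X.ratio hnd l ≠ 0 := by
  intro h
  refine hl (Subtype.ext (hnd _ l.2 (X.mem_ideal_of_restrictLinear_eq_zero _ l.2 ?_)))
  exact (X.O1Frame hnd).val_injective (h.trans (X.O1Frame hnd).val_zero.symm)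

theorem ratio_sum_smul {ι : Type*} (s : Finset ι) (c : ι → k)
    (l : ι → MvPolynomial.homogeneousSubmodule (Fin (r + 1)) k 1) :
    X.ratio hnd (∑ i ∈ s, c i • l i) =
      ∑ i ∈ s, rationalScalar X.carrier k (c i) * X.ratio hnd (l i) := by
  rw [ratio, map_sum, LineBundle.Frame.val_sum]
  simp only [map_smul, LineBundle.Frame.val_smul, ratio]

theorem ratio_mul_eq (l₁ l₂ l₃ l₄ : MvPolynomial.homogeneousSubmodule (Fin (r + 1)) k 1)
    (h : l₁.1 * l₂.1 - l₃.1 * l₄.1 ∈ X.ideal) :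
    X.ratio hnd l₁ * X.ratio hnd l₂ = X.ratio hnd l₃ * X.ratio hnd l₄ := by
  let F := X.O1Frame hnd
  have e := congrArg (toRational (F.ne F.base)) (X.pull_frac_mul_eq F.base.down _ _ _ _ l₁.2 l₂.2
    l₃.2 l₄.2 h (V := X.O1.U F.base) le_rfl)
  rw [map_mul, map_mul] at e
  have e' : toRational (F.ne F.base) ((X.linearRestriction l₁).1 F.base) *
      toRational (F.ne F.base) ((X.linearRestriction l₂).1 F.base) =
      toRational (F.ne F.base) ((X.linearRestriction l₃).1 F.base) *
      toRational (F.ne F.base) ((X.linearRestriction l₄).1 F.base) := e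
  rw [F.toRational_apply, F.toRational_apply, F.toRational_apply, F.toRational_apply] at e'
  have := F.fn_ne_zero F.base
  field_simp at e'
  exact e'

end ProjectiveVariety

/-! ### Line bundles and divisors from primitive vectors. -/

theorem associated_of_div_mem {X : Scheme.{u}} [AlgebraicGeometry.IsIntegral X] {U : X.Opens}
    (hU : Nonempty U) (f g : Γ(X, U)) (hf : toRational hU f ≠ 0) (hg : toRational hU g ≠ 0)
    (h : ∀ x ∈ U, toRational hU g / toRational hU f ∈ localSubring X x)
    (h' : ∀ x ∈ U, toRational hU f / toRational hU g ∈ localSubring X x) : Associated f g := by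
  obtain ⟨q, hq⟩ := exists_toRational_eq hU _ h
  have hu : IsUnit q := by
    refine isUnit_of_inv_mem hU q ?_ ?_ <;> rw [hq]
    · exact div_ne_zero hg hf
    · simpa only [inv_div] using h'
  refine ⟨hu.unit, toRational_injective hU ?_⟩
  rw [map_mul, IsUnit.unit_spec, hq, mul_div_cancel₀ _ hf]

namespace LineBundle

theorem exists_mem_U {X : Scheme.{u}} (L : LineBundle X) (x : X) : ∃ i, x ∈ L.U i := by
  have hx : x ∈ ⨆ i, L.U i := by rw [L.cover]; trivial
  exact Opens.mem_iSup.1 hx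

variable {X : Scheme.{u}} [AlgebraicGeometry.IsIntegral X]

theorem Frame.fn_div_fn_mem {L : LineBundle X} (F : Frame L) (i j : L.I) (x : X)
    (hi : x ∈ L.U i) (hj : x ∈ L.U j) : F.fn j / F.fn i ∈ localSubring X x := by
  rw [← F.toRational_g]
  exact toRational_mem _ _ x ⟨hi, hj⟩

/-- The vector of rational functions `v` is, in each trivialisation, a primitive vector of
regular functions. -/
def Frame.IsPrimitive {L : LineBundle X} (F : Frame L) {ι : Type*} (v : ι → X.functionField) :
    Prop :=
  ∀ p, ∀ y ∈ L.U p, _root_.IsPrimitive (localSubring X y) fun i => v i / F.fn p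

theorem Frame.IsPrimitive.exists_val_eq {L : LineBundle X} {F : Frame L} {ι : Type*}
    {v : ι → X.functionField} (h : F.IsPrimitive v) : ∃ s : ι → L.H0, ∀ i, F.val (s i) = v i :=
  ⟨fun i => (F.exists_val_eq (v i) fun p y hy => (h p y hy).mem i).choose,
    fun i => (F.exists_val_eq (v i) fun p y hy => (h p y hy).mem i).choose_spec⟩

section Smooth

variable {k : Type u} [Field k] [X.Over (Spec (.of k))]

/-- Each point has a neighbourhood with a local gcd `d` of `v`. On overlaps `v / d p` and `v / d q`
are both primitive, so `d q / d p` is regular and `d` is the frame of a line bundle. -/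
theorem exists_frame_isPrimitive [IsAlgClosed k] (hsm : Smooth (X ↘ Spec (.of k))) {ι : Type*}
    [Finite ι] (v : ι → X.functionField) (hv : ∃ i, v i ≠ 0) :
    ∃ (L : LineBundle X) (F : Frame L), F.IsPrimitive v := by
  choose U hU d hd hprim using exists_isPrimitive_nhds hsm v hv
  have hne x : Nonempty (U x) := ⟨⟨x, hU x⟩⟩
  have hcover : ⨆ x, U x = ⊤ := top_unique fun x _ => Opens.mem_iSup.2 ⟨x, hU x⟩
  have hdiv : ∀ p q, ∀ y ∈ U p ⊓ U q, d q / d p ∈ localSubring X y := by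
    intro p q y hy
    refine (hprim q y hy.2).mem_of_mul ?_
    refine Eq.subst (motive := _root_.IsPrimitive (localSubring X y : Set X.functionField))
      (funext fun i => ?_) (hprim p y hy.1)
    have := hd p
    have := hd q
    field_simp
  obtain ⟨x₀⟩ := (inferInstance : Nonempty X)
  exact ⟨_, ofRationalFrame x₀ U hne hcover d hd hdiv, hprim⟩

theorem Frame.IsPrimitive.noFixedComponent (hsm : Smooth (X ↘ Spec (.of k))) {L : LineBundle X}
    {F : Frame L} {ι : Type*} {v : ι → X.functionField} (h : F.IsPrimitive v) (s : ι → L.H0)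
    (hs : ∀ i, F.val (s i) = v i) (V : Submodule k L.H0) (hV : ∀ i, s i ∈ V) :
    NoFixedComponent V := by
  intro x hx
  obtain ⟨p, hp⟩ := L.exists_mem_U x
  obtain ⟨i, hi⟩ := exists_mem_basicOpen_of_isPrimitive hsm (F.ne p) (fun i => (s i).1 p) x hp hx
    (by simpa only [F.toRational_apply, hs] using h p x hp)
  exact ⟨s i, hV i, fun hvan => hvan p hp hi⟩

end Smooth

/-- The equation of `B` is `q = F₁ * F₂ / F`, which plays the role of a gcd of the local functions
of the `m i j`. Since `F * q = F₁ * F₂`, the isomorphism of `L₁ ⊗ L₂` with `L(-B)` is the identity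
on rational functions, that is, it has scale `1`. -/
theorem Frame.IsPrimitive.exists_divisor {L₁ L₂ L : LineBundle X} {F₁ : Frame L₁} {F₂ : Frame L₂}
    (F : Frame L) {ι κ : Type*} {v : ι → X.functionField} {w : κ → X.functionField}
    (hv : F₁.IsPrimitive v) (hw : F₂.IsPrimitive w) (m : ι → κ → L.H0)
    (hm : ∀ i j, F.val (m i j) = v i * w j) :
    ∃ (B : EffectiveDivisor X) (b₀ : B.I) (hB : ∀ b, Nonempty (B.U b))
      (φ : Hom (L₁.tensor L₂) (L.twistNeg B)),
      HasScale (F₁.tensor F₂) (F.tensor (divisorFrame B b₀ hB).dual) φ 1 ∧ φ.IsIso := by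
  let U : L₁.I × L₂.I × L.I → X.Opens := fun p => L₁.U p.1 ⊓ L₂.U p.2.1 ⊓ L.U p.2.2
  let q : L₁.I × L₂.I × L.I → X.functionField := fun p =>
    F₁.fn p.1 * F₂.fn p.2.1 / F.fn p.2.2
  have hU p : Nonempty (U p) := nonempty_inf (nonempty_inf (F₁.ne _) (F₂.ne _)) (F.ne _)
  have hq p : q p ≠ 0 :=
    div_ne_zero (mul_ne_zero (F₁.fn_ne_zero _) (F₂.fn_ne_zero _)) (F.fn_ne_zero _)
  have hreg : ∀ p, ∀ x ∈ U p, q p ∈ localSubring X x := by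
    rintro ⟨p₁, p₂, p⟩ x ⟨⟨hx₁, hx₂⟩, hx⟩
    -- Primitivity of `v` and then of `w` reduces regularity of `q` to that of every `q * (v i / F₁)
    -- * (w j / F₂)`, which is the local function of the section `m i j`.
    refine (hv p₁ x hx₁ _).1 fun i => ?_
    refine (hw p₂ x hx₂ _).1 fun j => ?_
    have e : F₁.fn p₁ * F₂.fn p₂ / F.fn p * (v i / F₁.fn p₁) * (w j / F₂.fn p₂) =
        toRational (F.ne p) ((m i j).1 p) := by
      rw [F.toRational_apply, hm]
      have := F₁.fn_ne_zero p₁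
      have := F₂.fn_ne_zero p₂
      field_simp
    exact e ▸ toRational_mem (F.ne p) _ x hx
  have hdiv : ∀ p p', ∀ x ∈ U p ⊓ U p', q p' / q p ∈ localSubring X x := by
    rintro ⟨p₁, p₂, p⟩ ⟨p₁', p₂', p'⟩ x ⟨⟨⟨hx₁, hx₂⟩, hx⟩, ⟨⟨hx₁', hx₂'⟩, hx'⟩⟩
    have e : q ⟨p₁', p₂', p'⟩ / q ⟨p₁, p₂, p⟩ =
        F₁.fn p₁' / F₁.fn p₁ * (F₂.fn p₂' / F₂.fn p₂) * (F.fn p / F.fn p') := by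
      simp only [q]
      have := F₁.fn_ne_zero p₁
      have := F₂.fn_ne_zero p₂
      have := F.fn_ne_zero p
      have := F.fn_ne_zero p'
      field_simp
    rw [e]
    exact mul_mem (mul_mem (F₁.fn_div_fn_mem _ _ x hx₁ hx₁') (F₂.fn_div_fn_mem _ _ x hx₂ hx₂'))
      (F.fn_div_fn_mem _ _ x hx' hx)
  choose f hf using fun p => exists_toRational_eq (hU p) _ (hreg p)
  let B : EffectiveDivisor X :=
    { I := L₁.I × L₂.I × L.I
      U := U
      cover := by
        refine top_unique fun x _ => Opens.mem_iSup.2 ?_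
        obtain ⟨p₁, h₁⟩ := L₁.exists_mem_U x
        obtain ⟨p₂, h₂⟩ := L₂.exists_mem_U x
        obtain ⟨p, h⟩ := L.exists_mem_U x
        exact ⟨(p₁, p₂, p), ⟨⟨h₁, h₂⟩, h⟩⟩
      f := f
      regular := by
        intro p W h
        by_cases hW : Nonempty W
        · refine mem_nonZeroDivisors_of_ne_zero fun h0 => hq p ?_
          rw [← hf, ← toRational_res (hU p) hW h, h0, map_zero]
        · exact mem_nonZeroDivisors_iff_right.2 fun _ _ => section_eq_of_isEmpty hW _ _
      assoc := by
        intro p p'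
        refine associated_of_div_mem (nonempty_inf (hU p) (hU p')) _ _ ?_ ?_ ?_ ?_ <;>
          rw [toRational_res (hU _), hf] <;> try rw [toRational_res (hU _), hf]
        · exact hq _
        · exact hq _
        · exact fun x hx => hdiv _ _ x ⟨hx.2, hx.1⟩
        · exact fun x hx => hdiv _ _ x hx }
  have hB : ∀ b : B.I, (divisorFrame B (F₁.base, F₂.base, F.base) hU).dual.fn b = q b := by
    intro b
    exact (inv_inv _).trans (hf b)
  -- The local factor is a product of transition functions of `L₁`, `L₂` and `L`, so both it and its
  -- inverse are regular.
  have hc : ∀ j i, 1 * (F₁.tensor F₂).fn i /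
      (F.tensor (divisorFrame B (F₁.base, F₂.base, F.base) hU).dual).fn j =
      F₁.fn i.1 / F₁.fn j.2.1 * (F₂.fn i.2 / F₂.fn j.2.2.1) * (F.fn j.2.2.2 / F.fn j.1) := by
    rintro ⟨l, p₁, p₂, p⟩ ⟨i₁, i₂⟩
    change 1 * (F₁.fn i₁ * F₂.fn i₂) / (F.fn l * _) = _
    rw [hB]
    simp only [q]
    have := F₁.fn_ne_zero p₁
    have := F₂.fn_ne_zero p₂
    have := F.fn_ne_zero p
    have := F.fn_ne_zero l
    field_simp
  obtain ⟨φ, hφ⟩ := exists_hasScale (F₁.tensor F₂)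
    (F.tensor (divisorFrame B (F₁.base, F₂.base, F.base) hU).dual) 1 (by
      rintro j i x ⟨⟨hx, ⟨hx₁, hx₂⟩, hx₃⟩, hy₁, hy₂⟩
      rw [hc]
      exact mul_mem (mul_mem (F₁.fn_div_fn_mem _ _ x hx₁ hy₁) (F₂.fn_div_fn_mem _ _ x hx₂ hy₂))
        (F.fn_div_fn_mem _ _ x hx hx₃))
  refine ⟨B, (F₁.base, F₂.base, F.base), hU, φ, hφ, hφ.isIso one_ne_zero ?_⟩
  rintro j i x ⟨⟨hx, ⟨hx₁, hx₂⟩, hx₃⟩, hy₁, hy₂⟩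
  rw [hc, mul_inv, mul_inv, inv_div, inv_div, inv_div]
  exact mul_mem (mul_mem (F₁.fn_div_fn_mem _ _ x hy₁ hx₁) (F₂.fn_div_fn_mem _ _ x hy₂ hx₂))
    (F.fn_div_fn_mem _ _ x hx₃ hx)

/-- In each pair of charts multiplication by `c` carries one primitive vector to another, so its
local factor is a unit. -/
theorem Frame.IsPrimitive.exists_hasScale_isIso {L₁ L₂ : LineBundle X} {F₁ : Frame L₁}
    {F₂ : Frame L₂} {ι : Type*} {v : ι → X.functionField} {w : ι → X.functionField}
    (hv : F₁.IsPrimitive v) (hw : F₂.IsPrimitive w) (c : X.functionField) (hc : c ≠ 0)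
    (h : ∀ i, w i = c * v i) : ∃ φ : Hom L₁ L₂, HasScale F₁ F₂ φ c ∧ φ.IsIso := by
  have key : ∀ j i, ∀ x ∈ L₂.U j ⊓ L₁.U i, _root_.IsPrimitive (localSubring X x)
      fun l => c * F₁.fn i / F₂.fn j * (v l / F₁.fn i) := by
    intro j i x hx
    refine Eq.subst (motive := _root_.IsPrimitive (localSubring X x : Set X.functionField))
      (funext fun l => ?_) (hw j x hx.1)
    rw [h]
    have := F₁.fn_ne_zero i
    field_simp
  obtain ⟨φ, hφ⟩ := exists_hasScale F₁ F₂ c fun j i x hx => (hv i x hx.2).mem_of_mul (key j i x hx)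
  exact ⟨φ, hφ, hφ.isIso hc fun j i x hx => (hv i x hx.2).inv_mem_of_mul
    (div_ne_zero (mul_ne_zero hc (F₁.fn_ne_zero i)) (F₂.fn_ne_zero j)) (key j i x hx)⟩

end LineBundle

/-! ### One-generic matrices of linear forms, and their restriction to `X`. -/

theorem IsOneGeneric.sum_ne_zero {k : Type u} [Field k] {r a b : ℕ}
    {M : Matrix (Fin a) (Fin b) (MvPolynomial (Fin (r + 1)) k)} (hM : IsOneGeneric M)
    (c : Fin a → k) (d : Fin b → k) (hc : c ≠ 0) (hd : d ≠ 0) :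
    ∑ i, ∑ j, (c i * d j) • M i j ≠ 0 := by
  -- Every nonzero vector is a row of an invertible matrix: putting `c` in row `p` of the identity
  -- gives determinant `c p`. Hence 1-genericity rules out every relation `cᵀ M d = 0` with `c, d ≠
  -- 0`.
  have hGL : ∀ {n : ℕ} (c : Fin n → k), c ≠ 0 → ∃ (A : GL (Fin n) k) (p : Fin n), A.1 p = c := by
    intro n c hc
    obtain ⟨p, hp⟩ := Function.ne_iff.1 hc
    have hdet : ((1 : Matrix (Fin n) (Fin n) k).updateRow p c).det = c p := by
      rw [← Matrix.cramer_transpose_apply, Matrix.transpose_one, Matrix.cramer_one]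
      rfl
    refine ⟨Matrix.GeneralLinearGroup.mkOfDetNeZero _ (hdet.trans_ne hp), p, ?_⟩
    exact Matrix.updateRow_self
  obtain ⟨A, p, hA⟩ := hGL c hc
  obtain ⟨B, q, hB⟩ := hGL d hd
  convert hM A B p q
  simp only [Matrix.mul_apply, Matrix.map_apply, Matrix.transpose_apply, hA, hB, Finset.sum_mul]
  rw [Finset.sum_comm]
  refine Finset.sum_congr rfl fun j _ => Finset.sum_congr rfl fun i _ => ?_
  rw [MvPolynomial.smul_eq_C_mul, map_mul]
  ring

theorem minor_mem_minorIdeal {R : Type u} [CommRing R] {a b : ℕ} (M : Matrix (Fin a) (Fin b) R)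
    (i₀ i : Fin a) (j₀ j : Fin b) (hi : i₀ < i) (hj : j₀ < j) :
    M i₀ j₀ * M i j - M i₀ j * M i j₀ ∈ minorIdeal 2 M := by
  have hmono : ∀ {n : ℕ} {x y : Fin n}, x < y → StrictMono ![x, y] := by
    intro n x y h s t hst
    fin_cases s <;> fin_cases t <;> simp_all
  refine Ideal.subset_span ⟨OrderEmbedding.ofStrictMono _ (hmono hi),
    OrderEmbedding.ofStrictMono _ (hmono hj), ?_⟩
  rw [Matrix.det_fin_two]
  rfl

namespace ProjectiveVariety

variable {k : Type u} [Field k] {r : ℕ} (X : ProjectiveVariety k r) (hnd : X.IsNondegenerate)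
  {a b : ℕ} (M : Matrix (Fin a) (Fin b) (MvPolynomial (Fin (r + 1)) k)) (hlin : IsLinearMatrix M)

/-- The entries of a linear matrix, as rational functions on `X`. -/
noncomputable def matrixRatio (i : Fin a) (j : Fin b) : X.carrier.functionField :=
  X.ratio hnd ⟨M i j, hlin i j⟩

/-- Minors are indexed by increasing rows and columns, so the indices are compared with `≤`; this
suffices because `i₀` and `j₀` will be the least ones. -/
theorem matrixRatio_mul_matrixRatio (hminors : minorIdeal 2 M ≤ X.ideal) (i₀ i : Fin a)
    (j₀ j : Fin b) (hi : i₀ ≤ i) (hj : j₀ ≤ j) :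
    X.matrixRatio hnd M hlin i₀ j₀ * X.matrixRatio hnd M hlin i j =
      X.matrixRatio hnd M hlin i₀ j * X.matrixRatio hnd M hlin i j₀ := by
  obtain rfl | hi := hi.eq_or_lt
  · exact mul_comm _ _
  obtain rfl | hj := hj.eq_or_lt
  · rfl
  exact X.ratio_mul_eq hnd _ _ _ _ (hminors (minor_mem_minorIdeal M i₀ i j₀ j hi hj))

variable {M} in
-- The form `cᵀ M d` is nonzero by 1-genericity, and nondegeneracy keeps its restriction to `X`
-- nonzero. The linear independence of both bases comes from this.
theorem sum_matrixRatio_ne_zero (hgen : IsOneGeneric M) (c : Fin a → k) (d : Fin b → k)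
    (hc : c ≠ 0) (hd : d ≠ 0) :
    ∑ i, ∑ j, rationalScalar X.carrier k (c i) *
      (rationalScalar X.carrier k (d j) * X.matrixRatio hnd M hlin i j) ≠ 0 := by
  have h := X.ratio_ne_zero hnd
    (∑ p : Fin a × Fin b, (c p.1 * d p.2) • ⟨M p.1 p.2, hlin p.1 p.2⟩) (by
      intro h0
      refine hgen.sum_ne_zero c d hc hd ?_
      have := congrArg Subtype.val h0
      rw [AddSubmonoidClass.coe_finsetSum, Fintype.sum_prod_type] at this
      exact this)
  rw [X.ratio_sum_smul, Fintype.sum_prod_type] at h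
  simp only [map_mul, mul_assoc] at h
  exact h

variable {M} in
theorem matrixRatio_ne_zero (hgen : IsOneGeneric M) (i : Fin a) (j : Fin b) :
    X.matrixRatio hnd M hlin i j ≠ 0 := by
  have h := X.sum_matrixRatio_ne_zero hnd hlin hgen (Pi.single i 1) (Pi.single j 1)
    (by simp) (by simp)
  simpa [Pi.single_apply, apply_ite (rationalScalar X.carrier k)] using h

end ProjectiveVariety

namespace LineBundle

theorem Frame.linearIndependent {X : Scheme.{u}} [AlgebraicGeometry.IsIntegral X] {k : Type u}
    [Field k] [X.Over (Spec (.of k))] {L : LineBundle X} (F : Frame L) {ι : Type*} [Fintype ι]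
    (s : ι → L.H0)
    (h : ∀ c : ι → k, c ≠ 0 → ∑ i, rationalScalar X k (c i) * F.val (s i) ≠ 0) :
    LinearIndependent k s := by
  refine Fintype.linearIndependent_iff.2 fun c hc => ?_
  by_contra! hne
  refine h c (Function.ne_iff.2 hne) ?_
  have := congrArg F.val hc
  simpa only [F.val_zero, F.val_sum, F.val_smul] using this

end LineBundle

end DetPres

/-! ### The factorisation of the matrix. -/

theorem mainTheorem6 {k : Type u} [Field k] [IsAlgClosed k] [CharZero k] (r : ℕ)
    (X : DetPres.ProjectiveVariety k r) (hnd : X.IsNondegenerate) (hsm : X.IsSmooth)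
    (a b : ℕ) (ha : 0 < a) (hb : 0 < b)
    (M : Matrix (Fin a) (Fin b) (MvPolynomial (Fin (r + 1)) k))
    (hlin : DetPres.IsLinearMatrix M) (hgen : DetPres.IsOneGeneric M)
    (hminors : DetPres.minorIdeal 2 M ≤ X.ideal) :
    ∃ (L₁ L₂ : DetPres.LineBundle X.carrier) (V₁ : Submodule k L₁.H0) (V₂ : Submodule k L₂.H0)
      (B : DetPres.EffectiveDivisor X.carrier)
      (s : Module.Basis (Fin a) k V₁) (t : Module.Basis (Fin b) k V₂)
      (φ : DetPres.LineBundle.Hom (L₁.tensor L₂) (X.O1.twistNeg B)),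
      φ.IsIso ∧
      (∀ i j, X.restrictLinear (M i j) (hlin i j) =
        (X.O1.mulDefiningSection B).map
          (φ.map (DetPres.LineBundle.mulSection (s i : L₁.H0) (t j : L₂.H0)))) ∧
      (∀ h : a = b, (M.submatrix id (Fin.cast h)).IsSymm →
        ∃ ψ : DetPres.LineBundle.Hom L₁ L₂, ψ.IsIso ∧
          ∃ α : k, α ≠ 0 ∧ ∀ i, ψ.map (s i : L₁.H0) = α • (t (Fin.cast h i) : L₂.H0)) ∧
      DetPres.LineBundle.NoFixedComponent V₁ ∧ DetPres.LineBundle.NoFixedComponent V₂ := by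
  let i₀ : Fin a := ⟨0, ha⟩
  let j₀ : Fin b := ⟨0, hb⟩
  let m := X.matrixRatio hnd M hlin
  have hm i j : m i j ≠ 0 := X.matrixRatio_ne_zero hnd hlin hgen i j
  -- A rank one factorisation normalised by `v i₀ = 1`; the pivot `m i₀ j₀` is nonzero by
  -- 1-genericity.
  let v : Fin a → X.carrier.functionField := fun i => m i j₀ / m i₀ j₀
  let w : Fin b → X.carrier.functionField := fun j => m i₀ j
  have hvw i j : m i j = v i * w j := by
    have h := X.matrixRatio_mul_matrixRatio hnd M hlin hminors i₀ i j₀ j (Nat.zero_le _)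
      (Nat.zero_le _)
    change m i₀ j₀ * m i j = m i₀ j * m i j₀ at h
    have := hm i₀ j₀
    simp only [v, w]
    field_simp
    linear_combination h
  obtain ⟨L₁, F₁, h₁⟩ := DetPres.LineBundle.exists_frame_isPrimitive hsm v
    ⟨i₀, div_ne_zero (hm _ _) (hm _ _)⟩
  obtain ⟨L₂, F₂, h₂⟩ := DetPres.LineBundle.exists_frame_isPrimitive hsm w ⟨j₀, hm _ _⟩
  obtain ⟨s, hs⟩ := h₁.exists_val_eq
  obtain ⟨t, ht⟩ := h₂.exists_val_eq
  -- After multiplication by the pivot, a relation among the `s i` says that a combination of the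
  -- entries in column `j₀` vanishes on `X`.
  have hsli : LinearIndependent k s := by
    refine F₁.linearIndependent s fun c hc h0 => ?_
    refine X.sum_matrixRatio_ne_zero hnd hlin hgen c (Pi.single j₀ 1) hc (by simp) ?_
    have := congrArg (· * m i₀ j₀) h0
    rw [zero_mul, Finset.sum_mul] at this
    rw [← this]
    refine Finset.sum_congr rfl fun i _ => ?_
    rw [hs, mul_assoc, div_mul_cancel₀ _ (hm _ _)]
    simp [Pi.single_apply, apply_ite (DetPres.rationalScalar X.carrier k), m]
  have htli : LinearIndependent k t := by
    refine F₂.linearIndependent t fun d hd h0 => ?_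
    refine X.sum_matrixRatio_ne_zero hnd hlin hgen (Pi.single i₀ 1) d (by simp) hd ?_
    simpa [Pi.single_apply, apply_ite (DetPres.rationalScalar X.carrier k), ht, w, m] using h0
  obtain ⟨B, b₀, hB, φ, hφ, hφiso⟩ := h₁.exists_divisor (X.O1Frame hnd) h₂
    (fun i j => X.restrictLinear (M i j) (hlin i j)) hvw
  refine ⟨L₁, L₂, Submodule.span k (Set.range s), Submodule.span k (Set.range t), B,
    Module.Basis.span hsli, Module.Basis.span htli, φ, hφiso, fun i j => ?_, ?_,
    h₁.noFixedComponent hsm s hs _ fun i => Submodule.subset_span ⟨i, rfl⟩,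
    h₂.noFixedComponent hsm t ht _ fun j => Submodule.subset_span ⟨j, rfl⟩⟩
  -- Both sides are compared as rational functions, where `φ` and multiplication by the defining
  -- section have scale `1`.
  · refine (X.O1Frame hnd).val_injective ?_
    refine (hvw i j).trans (Eq.symm ?_)
    refine ((DetPres.LineBundle.hasScale_mulDefiningSection (X.O1Frame hnd) B b₀ hB).val_map _).trans ?_
    refine (one_mul _).trans ((hφ.val_map _).trans ((one_mul _).trans ?_))
    rw [DetPres.LineBundle.Frame.val_mulSection, Module.Basis.span_apply, Module.Basis.span_apply, hs, ht]
  · rintro rfl hsymm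
    -- By symmetry the first row equals the first column, so `w` is `v` times the pivot. The
    -- isomorphism is multiplication by the pivot itself, which leaves `α = 1`.
    have h i : w i = m i₀ j₀ * v i := by
      have e : m i₀ i = m i j₀ := congrArg (X.ratio hnd) (Subtype.ext (hsymm.apply i i₀))
      simp only [w, v]
      rw [e, mul_div_cancel₀ _ (hm _ _)]
    obtain ⟨ψ, hψ, hψiso⟩ := h₁.exists_hasScale_isIso h₂ (m i₀ j₀) (hm _ _) h
    refine ⟨ψ, hψiso, 1, one_ne_zero, fun i => F₂.val_injective ?_⟩
    rw [hψ.val_map, one_smul, Module.Basis.span_apply, Module.Basis.span_apply, hs, ht]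
    exact (h i).symm
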